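/- **Setting.** A Streett automaton $\mathcal A=\langle Q,Q_0,\Sigma,\Delta,\langle G,B\rangle_I\rangle$ has a finite state set $Q$ with $|Q|=n$, initial states $Q_0\subseteq Q$, transitions $\Delta\subseteq Q\times\Sigma\times Q$, an index set $I=[1..k]$, and functions $G,B:I\to 2^Q$. Put $\mu=\min(n,k)$, and write $\lg$ for the logarithm to base $2$. **Minimal extensions.** For a finite sequence $\alpha$ over $I$ let $U_\alpha=\bigcup_i B(\alpha[i])$ and $\mathrm{Cover}(\alpha)=\{j\in I: B(j)\subseteq U_\alpha\}$. Let $\mathrm{Mini}(\alpha)$ be the set of $j\in I\setminus \mathrm{Cover}(\alpha)$ such that, for all $j'\in I\setminus\mathrm{Cover}(\alpha)$: if $j'\ne j$ then $B(j')\cup U_\alpha\not\subsetneq B(j)\cup U_\alpha$, and if $j'<j$ then $B(j')\cup U_\alpha\neq B(j)\cup U_\alpha$. **Reduced Safra trees (RSTS).** An RSTS is a finite ordered tree (possibly empty) in which every node $v$ carries a name $L_n(v)\in[1..n(\mu+1)]$, distinct for distinct nodes, a nonempty set $L_s(v)\subseteq Q$, a colour (green, red or yellow), and an index $L_h(v)\in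 I\cup\{0\}$, with $L_h(\text{root})=0$. Let $L_h^{\to}(v)$ be the sequence of nonzero indices from the root to $v$. It is required that: - the sets of siblings are pairwise disjoint, and the set of a non-leaf is the union of the sets of its children; - no index repeats in $L_h^{\to}(v)$, every child of $v$ has its index in $\mathrm{Mini}(L_h^{\to}(v))\cup\{0\}$, and $\mathrm{Mini}(L_h^{\to}(v))=\emptyset$ for every leaf $v$; - siblings are ordered from left to right by decreasing index, those with equal index from the oldest to the youngest; - a left spine is a maximal path $v_1\cdots v_m$ in which $v_1$ (the head) is not a leftmost child, each $v_{i+1}$ is the leftmost child of $v_i$, and $v_m$ is a leaf; each left spine has a bucket $b\in[1..n]$ such that $L_n(v_i)=(\mu+1)(b-1)+i$. **Transformation.** A tree $t$ is transformed under a letter $a$ as follows. 1. *Subset construction.* Replace each $L_s(v)$ by its set of $a$-successors. 2. *Expansion*, from the root downwards. For each node $v$ that is not a leaf and each child $u$ of $v$ with $i=L_h(u)\ne0$: if $S=L_s(u)\cap B(i)\neq\emptyset$, then add to $v$ a new child with set $S$ and index $\max\big(\{j\in\mathrm{Mini}(L_h^{\to}(v)):j<i\}\cup\{0\}\big)$;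 otherwise, if $S=L_s(u)\cap G(i)\ne\emptyset$, add to $v$ a new child with set $S$ and index $i$. In both cases remove $S$ from $u$ and all its descendants. A new child is younger than its siblings and is placed according to the order of siblings. 3. *Horizontal merge.* If $q$ lies in the sets of two siblings $v,v'$ and $L_h(v)<L_h(v')$, or $L_h(v)=L_h(v')$ and $v$ is older, remove $q$ from $v'$ and its descendants. Then remove all nodes with empty set. 4. *Vertical merge.* If all children of $v$ have index $0$, remove all descendants of $v$ (this includes, trivially, the case that $v$ is a leaf). 5. *Growing.* While there is a leaf $v$ with $\mathrm{Mini}(L_h^{\to}(v))\neq\emptyset$, add to it a child with set $L_s(v)$ and index $\max\mathrm{Mini}(L_h^{\to}(v))$. 6. *Naming.* The names on each left spine are the initial names of one bucket, as required above. A left spine whose head existed in $t$ keeps the bucket of its head; every other one gets an unused bucket, selected by some fixed strategy. 7. *Colouring.* Nodes that are new or have changed their name are red; of the others, those to which vertical merge was applied are green and the rest are yellow. **The automaton $\mathcal B$.** The initial state $\tilde q_0$ is obtained by growing, as in step 5, the tree with a single root with set $Q_0$ and index $0$, with names $1,2,\dots$ and all nodes red (the empty tree if $Q_0=\emptyset$).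 The state set $\tilde Q$ of the deterministic Rabin automaton $\mathcal B=\langle\tilde Q,\tilde q_0,\Sigma,\tilde\Delta,[\tilde G,\tilde B]_{\tilde I}\rangle$ consists of $\tilde q_0$ and all trees that result from applying the transformation to any RSTS (reachable or not) under any letter, $\tilde\Delta$ is the transformation, and $\tilde I=[1..n(\mu+1)]$. The set $\tilde G(i)$ consists of the states that contain a red node named $i$ or no node named $i$, and $\tilde B(i)$ of the states that contain a green node named $i$. **Theorem (Streett determinization: complexity).** For every strategy of selecting unused buckets the following holds, with constants in $O(\cdot)$ that do not depend on $\mathcal A$, $n$, $k$ or the strategy. - For all $n\ge 2$ and any $k$, the set $\tilde Q$ is finite and $|\tilde Q|\le 2^{12n}(0.37n)^{n^2+8n}$; for $n\ge2$ this bound is $2^{O(n^2\lg n)}$. For any $n$ and $k$, $|\tilde I|=O(n^2)$. - If $k=O(n)$, that is, $1\le k\le cn$ for a constant $c$, then $|\tilde Q|=2^{O(n\lg n+nk\lg k)}$ for $n\ge 2$, and $|\tilde I|=O(nk)$ (here the constants may depend on $c$). -/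

import Mathlib

/-! Streett automata, reduced Safra trees, and the improved determinization procedure. -/

namespace StreettDet

/-- A nondeterministic Streett automaton with `k` pairs.  The index set `I = [1..k]` is
represented by the linear order `Fin k`.  `Δ q a` is the set of `a`-successors of `q`;
`G i` is the `i`-th enabling set and `B i` the `i`-th fulfilling set. -/
structure Streett (Sym Q : Type*) (k : ℕ) where
  Q₀ : Finset Q
  Δ : Q → Sym → Finset Q
  G : Fin k → Finset Q
  B : Fin k → Finset Q

/-- A deterministic Rabin automaton: a state set inside an ambient type, an initial state, a
transition function, and the Rabin pairs `(G i, B i)` for `i ∈ Idx`. -/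
structure DetRabin (Sym : Type*) where
  Carrier : Type*
  states : Set Carrier
  init : Carrier
  δ : Carrier → Sym → Carrier
  Idx : Finset ℕ
  G : ℕ → Set Carrier
  B : ℕ → Set Carrier

/-- Finite ordered forests with labelled nodes.  `cons x c r` is the forest whose leftmost tree
has a root labelled `x` with the forest `c` of children; `r` holds the remaining trees, that is,
the siblings to the right.  A finite ordered tree is a forest with at most one root. -/
inductive Forest (α : Type*) where
  | nil : Forest α
  | cons (x : α) (c r : Forest α) : Forest α

namespace Forest

/-- The labels of the roots, from left to right. -/
def roots {α : Type*} : Forest α → List α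
  | nil => []
  | cons x _ r => x :: roots r

/-- The labels of all nodes. -/
def nodes {α : Type*} : Forest α → List α
  | nil => []
  | cons x c r => x :: (nodes c ++ nodes r)

/-- Relabelling. -/
def map {α β : Type*} (g : α → β) : Forest α → Forest β
  | nil => nil
  | cons x c r => cons (g x) (map g c) (map g r)

end Forest

inductive Color where
  | green | red | yellow
  deriving DecidableEq

/-- The label `⟨L_n, L_s, L_c, L_h⟩` of a node.  The index `L_h` ranges over `I ∪ {0}`; the
value `0` is represented by the least element `⊥` of `WithBot (Fin k)`. -/
structure Label (Q : Type*) (k : ℕ) where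
  name : ℕ
  set : Finset Q
  color : Color
  idx : WithBot (Fin k)

/-- The label of a node in the course of a transition.  `old` is the name of the node before the
transition (`none` if the node has been created by it); `merged` tells whether vertical merge has
been applied to the node. -/
structure Work (Q : Type*) (k : ℕ) where
  old : Option ℕ
  set : Finset Q
  idx : WithBot (Fin k)
  merged : Bool

/-- `L_h^→` of a node, given `L_h^→` of its parent and `L_h` of the node. -/
def ext {k : ℕ} (α : List (Fin k)) : WithBot (Fin k) → List (Fin k)
  | none => α
  | some i => α ++ [i]

/-- The `j`-th name of the `i`-th bucket (buckets have size `μ + 1`). -/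
def nameOf (μ i j : ℕ) : ℕ := (μ + 1) * (i - 1) + j

/-- The bucket a name belongs to. -/
def bucketOf (μ m : ℕ) : ℕ := (m - 1) / (μ + 1) + 1

/-! ### Indices -/

section Procedure

variable {Sym Q : Type*} [DecidableEq Q] {k : ℕ} (A : Streett Sym Q k)

/-- The union of the `B(α[i])`. -/
def Streett.seen (α : List (Fin k)) : Finset Q := α.toFinset.biUnion A.B

def Streett.Cover (α : List (Fin k)) : Finset (Fin k) :=
  Finset.univ.filter fun j => A.B j ⊆ A.seen α

def Streett.Mini (α : List (Fin k)) : Finset (Fin k) :=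
  Finset.univ.filter fun j => j ∉ A.Cover α ∧
    (∀ j', j' ∉ A.Cover α → j' ≠ j → ¬ (A.B j' ∪ A.seen α ⊂ A.B j ∪ A.seen α)) ∧
    (∀ j', j' ∉ A.Cover α → j' < j → A.B j' ∪ A.seen α ≠ A.B j ∪ A.seen α)

theorem Streett.mem_Cover {α : List (Fin k)} {j : Fin k} :
    j ∈ A.Cover α ↔ A.B j ⊆ A.seen α := by
  unfold Streett.Cover
  exact Finset.mem_filter.trans (and_iff_right (Finset.mem_univ j))

theorem Streett.seen_append (α : List (Fin k)) (i : Fin k) :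
    A.seen (α ++ [i]) = A.seen α ∪ A.B i := by
  ext q
  simp [Streett.seen, or_comm]

theorem Streett.card_uncovered_lt {α : List (Fin k)} {i : Fin k}
    (h : (A.Mini α).max = (i : WithBot (Fin k))) :
    (Finset.univ \ A.Cover (α ++ [i])).card < (Finset.univ \ A.Cover α).card := by
  have hi : i ∉ A.Cover α := (Finset.mem_filter.1 (Finset.mem_of_max h)).2.1
  refine Finset.card_lt_card ⟨fun j hj => ?_, fun hs => ?_⟩
  · rw [Finset.mem_sdiff, A.mem_Cover, A.seen_append] at hj
    rw [Finset.mem_sdiff, A.mem_Cover]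
    exact ⟨hj.1, fun hc => hj.2 (hc.trans Finset.subset_union_left)⟩
  · have h2 := hs (Finset.mem_sdiff.2 ⟨Finset.mem_univ i, hi⟩)
    rw [Finset.mem_sdiff, A.mem_Cover, A.seen_append] at h2
    exact h2.2 Finset.subset_union_right

/-! ### Reduced Safra trees -/

/-- The conditions on state and index labels for the forest of children of a node `v` with
`L_h^→(v) = α`, and recursively for their descendants: labels are nonempty, those of siblings are
pairwise disjoint, and the label of a node that is not a leaf is the union of the labels of its
children; index labels are in `Mini(α) ∪ {0}` and do not repeat on a path; a leaf has no minimal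
extension; siblings are ordered by decreasing index label (and, for equal index labels, from the
oldest to the youngest, so that age is encoded by position). -/
def Streett.Grown (α : List (Fin k)) : Forest (Label Q k) → Prop
  | .nil => True
  | .cons x c r =>
      x.set.Nonempty ∧
      (x.idx = ⊥ ∨ ∃ i ∈ A.Mini α, i ∉ α ∧ x.idx = (i : WithBot (Fin k))) ∧
      (∀ y ∈ r.roots, y.idx ≤ x.idx ∧ Disjoint x.set y.set) ∧
      (c = .nil → A.Mini (ext α x.idx) = ∅) ∧
      (c ≠ .nil → x.set = c.roots.foldr (fun y s => y.set ∪ s) ∅) ∧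
      Streett.Grown (ext α x.idx) c ∧ Streett.Grown α r

/-- The bucket condition on names.  With `some (b, i)`, the leftmost root is the `i`-th node of a
left spine to which the bucket `b` is assigned; with `none` it is the head of a left spine. -/
def Named (n μ : ℕ) : Option (ℕ × ℕ) → Forest (Label Q k) → Prop
  | _, .nil => True
  | some (b, i), .cons x c r =>
      x.name = nameOf μ b i ∧ Named n μ (some (b, i + 1)) c ∧ Named n μ none r
  | none, .cons x c r =>
      (∃ b ∈ Finset.Icc 1 n, x.name = nameOf μ b 1 ∧ Named n μ (some (b, 2)) c) ∧
      Named n μ none r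

/-- Reduced Safra trees for Streett determinization (the empty tree included). -/
def Streett.IsRSTS [Fintype Q] (t : Forest (Label Q k)) : Prop :=
  let n := Fintype.card Q
  let μ := min n k
  t.roots.length ≤ 1 ∧ (∀ x ∈ t.roots, x.idx = ⊥) ∧ A.Grown [] t ∧
  (t.nodes.map Label.name).Nodup ∧ (∀ x ∈ t.nodes, x.name ∈ Finset.Icc 1 (n * (μ + 1))) ∧
  Named n μ none t

/-! ### The transformation steps -/

/-- Subset construction. -/
def Streett.subsetStep (a : Sym) (t : Forest (Label Q k)) : Forest (Work Q k) :=
  t.map fun x => ⟨some x.name, x.set.biUnion fun q => A.Δ q a, x.idx, false⟩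

/-- Expansion at a child whose parent `v` has `L_h^→(v) = α`: given the state label `s` and the
index label of the child, the set of states that leave the child, and the index label of the new
child of `v` into which they move.  Nothing leaves if the set is empty, and nothing ever leaves a
child with index label `0`. -/
def Streett.move (α : List (Fin k)) (s : Finset Q) :
    WithBot (Fin k) → Finset Q × WithBot (Fin k)
  | none => (∅, ⊥)
  | some i =>
      if (s ∩ A.B i).Nonempty then (s ∩ A.B i, ((A.Mini α).filter (· < i)).max)
      else (s ∩ A.G i, (i : WithBot (Fin k)))

/-- The children created by expansion at a node with `L_h^→ = α` and the given forest of children,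
when the states in `R` have already been removed from that forest. -/
def Streett.fresh (α : List (Fin k)) (R : Finset Q) : Forest (Work Q k) → List (Work Q k)
  | .nil => []
  | .cons x _ r =>
      let m := A.move α (x.set \ R) x.idx
      if m.1.Nonempty then ⟨none, m.1, m.2, false⟩ :: Streett.fresh α R r
      else Streett.fresh α R r

/-- Insert a new childless sibling: it is younger than all existing ones, so its place is to the
right of the siblings with the same or a larger index label. -/
def insertChild (x : Work Q k) : Forest (Work Q k) → Forest (Work Q k)
  | .nil => .cons x .nil .nil
  | .cons y c r =>
      if y.idx < x.idx then .cons x .nil (.cons y c r) else .cons y c (insertChild x r)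

/-- Insert new siblings, one after the other. -/
def insertChildren (l : List (Work Q k)) (f : Forest (Work Q k)) : Forest (Work Q k) :=
  l.foldl (fun f x => insertChild x f) f

/-- The effect of expansion on the existing children of a node with `L_h^→ = α` and, recursively,
on their descendants.  `R` is the set of states already removed from the forest. -/
def Streett.stay (α : List (Fin k)) (R : Finset Q) : Forest (Work Q k) → Forest (Work Q k)
  | .nil => .nil
  | .cons x c r =>
      let R' := R ∪ (A.move α (x.set \ R) x.idx).1
      let β := ext α x.idx
      .cons { x with set := x.set \ R' }
        (insertChildren (A.fresh β R' c) (Streett.stay β R' c)) (Streett.stay α R r)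

/-- Expansion, from the root.  The root has index label `0`, so nothing leaves it. -/
def Streett.expand (t : Forest (Work Q k)) : Forest (Work Q k) := A.stay [] ∅ t

/-- Horizontal merge.  `R` is the set of states already removed from the forest (because they are
removed from an ancestor) and `l` holds the siblings to the left, which are older if they have
the same index label. -/
def hMerge (R : Finset Q) (l : List (Work Q k)) : Forest (Work Q k) → Forest (Work Q k)
  | .nil => .nil
  | .cons x c r =>
      let lost := x.set.filter fun q =>
        (∃ y ∈ l, q ∈ y.set ∧ y.idx ≤ x.idx) ∨ (∃ y ∈ r.roots, q ∈ y.set ∧ y.idx < x.idx)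
      .cons { x with set := x.set \ (R ∪ lost) } (hMerge (R ∪ lost) [] c) (hMerge R (l ++ [x]) r)

/-- Remove the nodes with empty state label. -/
def dropEmpty : Forest (Work Q k) → Forest (Work Q k)
  | .nil => .nil
  | .cons x c r =>
      if x.set = ∅ then dropEmpty r else .cons x (dropEmpty c) (dropEmpty r)

/-- Vertical merge: remove all descendants of a node all of whose children have index label `0`. -/
def vMerge : Forest (Work Q k) → Forest (Work Q k)
  | .nil => .nil
  | .cons x c r =>
      if ∀ y ∈ c.roots, y.idx = ⊥ then .cons { x with merged := true } .nil (vMerge r)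
      else .cons x (vMerge c) (vMerge r)

/-- The nodes added below a leaf `v` with `L_h^→(v) = α` and state label `s`. -/
def Streett.spine (s : Finset Q) (α : List (Fin k)) : Forest (Work Q k) :=
  match _h : (A.Mini α).max with
  | none => .nil
  | some i => .cons ⟨none, s, (i : WithBot (Fin k)), false⟩ (Streett.spine s (α ++ [i])) .nil
termination_by (Finset.univ \ A.Cover α).card
decreasing_by exact A.card_uncovered_lt _h

/-- Grow the left spines fully. -/
def Streett.grow (α : List (Fin k)) : Forest (Work Q k) → Forest (Work Q k)
  | .nil => .nil
  | .cons x .nil r => .cons x (A.spine x.set (ext α x.idx)) (Streett.grow α r)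
  | .cons x (.cons y c r') r => .cons x (Streett.grow (ext α x.idx) (.cons y c r')) (Streett.grow α r)

/-! ### Naming and colouring -/

/-- The buckets of the left spines whose head existed before the transition.  The flag tells
whether the leftmost root is the head of a left spine. -/
def keptBuckets (μ : ℕ) : Bool → Forest (Work Q k) → Finset ℕ
  | _, .nil => ∅
  | head, .cons x c r =>
      (if head then (x.old.map (bucketOf μ)).toFinset else ∅) ∪
        keptBuckets μ false c ∪ keptBuckets μ true r

/-- The final label of a node that gets the name `m`: nodes that are new or renamed are red,
otherwise nodes that lost all their descendants by vertical merge are green, and the others are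
yellow. -/
def Work.finish (x : Work Q k) (m : ℕ) : Label Q k :=
  ⟨m, x.set, if x.old = some m then (if x.merged then .green else .yellow) else .red, x.idx⟩

/-- Naming, from left to right.  With `some (b, i)`, the leftmost root is the `i`-th node of a
left spine with bucket `b`; with `none` it is the head of a left spine, which keeps its bucket if
the head is old, and gets the unused bucket `pick U` otherwise, `U` being the set of buckets in
use.  The result contains the updated set of buckets in use. -/
def assign (μ : ℕ) (pick : Finset ℕ → ℕ) :
    Option (ℕ × ℕ) → Finset ℕ → Forest (Work Q k) → Forest (Label Q k) × Finset ℕ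
  | _, U, .nil => (.nil, U)
  | some (b, i), U, .cons x c r =>
      let c' := assign μ pick (some (b, i + 1)) U c
      let r' := assign μ pick none c'.2 r
      (.cons (x.finish (nameOf μ b i)) c'.1 r'.1, r'.2)
  | none, U, .cons x c r =>
      let b := match x.old with
        | some m => bucketOf μ m
        | none => pick U
      let c' := assign μ pick (some (b, 2)) (insert b U) c
      let r' := assign μ pick none c'.2 r
      (.cons (x.finish (nameOf μ b 1)) c'.1 r'.1, r'.2)

/-! ### The output automaton -/

/-- A strategy for choosing an unused bucket for a new left spine: it may depend on the current
tree and letter, and on the set of buckets in use. -/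
def IsStrategy (n : ℕ) (pick : Forest (Label Q k) → Sym → Finset ℕ → ℕ) : Prop :=
  ∀ t a U, U ⊂ Finset.Icc 1 n → pick t a U ∈ Finset.Icc 1 n \ U

/-- The transition function. -/
def Streett.step [Fintype Q] (pick : Forest (Label Q k) → Sym → Finset ℕ → ℕ)
    (t : Forest (Label Q k)) (a : Sym) : Forest (Label Q k) :=
  let μ := min (Fintype.card Q) k
  let t' := A.grow [] (vMerge (dropEmpty (hMerge ∅ [] (A.expand (A.subsetStep a t)))))
  (assign μ (pick t a) none (keptBuckets μ true t') t').1

/-- The initial tree: the left spine grown from a root with state label `Q₀`, named from the first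
bucket.  (If `Q₀` is empty, then it is the empty tree, as nodes with empty label are removed.) -/
def Streett.initTree [Fintype Q] : Forest (Label Q k) :=
  (assign (min (Fintype.card Q) k) (fun _ => 1) none ∅
    (A.grow [] (dropEmpty (.cons ⟨none, A.Q₀, ⊥, false⟩ .nil .nil)))).1

/-- The output of the improved procedure.  Its states are the trees that carry names and colours
given by the naming and colouring rules: the initial tree, and every tree that the transformation
yields from any reduced Safra tree (reachable or not) under any letter. -/
def Streett.determinize [Fintype Q] (pick : Forest (Label Q k) → Sym → Finset ℕ → ℕ) :
    DetRabin Sym where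
  Carrier := Forest (Label Q k)
  states := {q | q = A.initTree ∨ ∃ t a, A.IsRSTS t ∧ q = A.step pick t a}
  init := A.initTree
  δ := A.step pick
  Idx := Finset.Icc 1 (Fintype.card Q * (min (Fintype.card Q) k + 1))
  G := fun i => {q | (∃ x ∈ q.nodes, x.name = i ∧ x.color = .red) ∨ ∀ x ∈ q.nodes, x.name ≠ i}
  B := fun i => {q | ∃ x ∈ q.nodes, x.name = i ∧ x.color = .green}

end Procedure

end StreettDet

/-! The states are counted through an injective code. A tree produced by the transformation is
determined by its leaves, listed from left to right, where each leaf carries its state set, its path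
`L_h^→`, and four data of the left spine ending in it: the bucket, a colour weight, the depth of the
head, and whether the head has index `0`. Decoding works for these reasons. Names follow from the
bucket and the position on the spine, colours from the weight, and the set of an inner node is the
union of its children's sets. After vertical merge and growing, a leftmost child never has index
`0`, so indices can be read off the path. A node is a leaf exactly if `Mini` of its path is empty.
The depths of the heads show where one subtree ends and its right neighbour begins
(`Streett.Coded.unique`).

Four facts bound the number of codes over `n = m + 1` states.

The leaf sets are nonempty and disjoint. So there are at most `n` leaves, the list of sets is a map
from the states to `n + 1` values, and an unused bucket is available for every new spine.

Along a left spine the colours are yellow, then at most one green, then red: a node can keep its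
name only if its parent on the spine does, and everything below a vertically merged node is new. So
at most `2n + 3` weights occur (`Streett.exists_weight`).

A step down the tree either has nonzero index and enlarges the set of seen states, or leads to a
child that is not leftmost and loses a state. Hence heads lie at depth at most `2n - 2`
(`Streett.exists_coded`).

The path of a leaf is a maximal sequence of minimal extensions. For `j` in `Mini α` the sets `B j \
A.seen α` form an antichain, so the LYM inequality yields at most `n!` such sequences by induction
(`Streett.ncard_maxPath_le`). As no index repeats, `(k + 1)^k` is another bound.

The rest is calculus. The number `0.37` exceeds `1/e`, and `n!` grows like `(n/e)^n` up to
polynomial factors; one such factor for each of at most `n` leaves gives the exponent `n²`. -/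

namespace StreettDet

/-! ### Invariants of the transformation -/

section Invariants

set_option linter.unusedSectionVars false

variable {Sym Q : Type*} {k : ℕ}

/-- `P α x cs rs` holds for every node `x` of the forest, where `α` is `L_h^→` of its parent,
`cs` are its children and `rs` its siblings to the right. -/
def Forest.All (P : List (Fin k) → Work Q k → List (Work Q k) → List (Work Q k) → Prop) :
    List (Fin k) → Forest (Work Q k) → Prop
  | _, .nil => True
  | α, .cons x c r => P α x c.roots r.roots ∧ Forest.All P (ext α x.idx) c ∧ Forest.All P α r

theorem Forest.roots_eq_nil {α : Type*} {f : Forest α} : f.roots = [] ↔ f = .nil := by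
  cases f <;> simp [Forest.roots]

variable [DecidableEq Q] (A : Streett Sym Q k)

/-- What holds at every node during the whole transformation. -/
structure Streett.Sound (μ N : ℕ) (α : List (Fin k)) (x : Work Q k) (cs rs : List (Work Q k)) :
    Prop where
  idx : x.idx = ⊥ ∨ ∃ i ∈ A.Mini α, x.idx = (i : WithBot (Fin k))
  sorted : ∀ y ∈ rs, y.idx ≤ x.idx
  union : cs ≠ [] → ∀ q, q ∈ x.set ↔ ∃ y ∈ cs, q ∈ y.set
  range : ∀ m, x.old = some m → m ∈ Finset.Icc 1 N
  -- A child was either a head, with the first name of a bucket, or a leftmost child, with the name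
  -- after its parent's. This speaks of old names only, so it persists when siblings are inserted or
  -- removed.
  link : ∀ y ∈ cs, ∀ m, y.old = some m →
    (∃ b, m = (μ + 1) * b + 1) ∨ ∃ m', x.old = some m' ∧ m = m' + 1

/-! #### Subset construction -/

theorem Forest.roots_map {α β : Type*} (g : α → β) :
    ∀ f : Forest α, (f.map g).roots = f.roots.map g
  | .nil => rfl
  | .cons x c r => by simp [Forest.map, Forest.roots, Forest.roots_map g r]

theorem mem_foldr_union (l : List (Label Q k)) (q : Q) :
    q ∈ l.foldr (fun y s => y.set ∪ s) ∅ ↔ ∃ y ∈ l, q ∈ y.set := by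
  induction l with
  | nil => simp
  | cons a l ih => simp [ih]

theorem Named.roots_none {n μ : ℕ} : ∀ {f : Forest (Label Q k)}, Named n μ none f →
    ∀ y ∈ f.roots, ∃ b, y.name = (μ + 1) * b + 1
  | .nil, _, y, hy => by simp [Forest.roots] at hy
  | .cons x c r, h, y, hy => by
      obtain ⟨⟨b, _, hb, _⟩, hr⟩ := h
      rcases List.mem_cons.1 hy with rfl | hy
      · exact ⟨b - 1, hb⟩
      · exact Named.roots_none hr y hy

theorem Named.roots_some {n μ b i : ℕ} {f : Forest (Label Q k)}
    (h : Named n μ (some (b, i + 1)) f) (y : Label Q k) (hy : y ∈ f.roots) :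
    (∃ b, y.name = (μ + 1) * b + 1) ∨ y.name = nameOf μ b i + 1 := by
  cases f with
  | nil => simp [Forest.roots] at hy
  | cons x c r =>
    obtain ⟨hx, _, hr⟩ := h
    rcases List.mem_cons.1 hy with rfl | hy
    · exact Or.inr hx
    · exact Or.inl (hr.roots_none y hy)

theorem Streett.sound_subsetStep {n μ N : ℕ} (a : Sym) :
    ∀ {α : List (Fin k)} {s : Option (ℕ × ℕ)} {t : Forest (Label Q k)},
      A.Grown α t → Named n μ s t → (∀ x ∈ t.nodes, x.name ∈ Finset.Icc 1 N) →
      (A.subsetStep a t).All (fun α x cs rs => A.Sound μ N α x cs rs ∧ x.merged = false) α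
  | _, _, .nil, _, _, _ => trivial
  | α, s, .cons x c r, hg, hn, hN => by
      obtain ⟨-, hidx, hsib, -, hun, hgc, hgr⟩ := hg
      have hn' : ∃ b i, x.name = nameOf μ b i ∧ Named n μ (some (b, i + 1)) c ∧
          Named n μ none r := by
        match s, hn with
        | some (b, i), hn => exact ⟨b, i, hn⟩
        | none, ⟨⟨b, _, h1, h2⟩, h3⟩ => exact ⟨b, 1, h1, h2, h3⟩
      obtain ⟨b, i, hx, hnc, hnr⟩ := hn'
      refine ⟨⟨?_, rfl⟩, Streett.sound_subsetStep a hgc hnc fun y hy => hN y ?_,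
        Streett.sound_subsetStep a hgr hnr fun y hy => hN y ?_⟩
      · constructor
        · rcases hidx with h | ⟨i, hi, -, h⟩
          exacts [Or.inl h, Or.inr ⟨i, hi, h⟩]
        · intro y hy
          change y ∈ (r.map _).roots at hy
          rw [Forest.roots_map] at hy
          obtain ⟨z, hz, rfl⟩ := List.mem_map.1 hy
          exact (hsib z hz).1
        · intro hc q
          change (c.map _).roots ≠ [] at hc
          have hc' : c ≠ .nil := by rintro rfl; exact hc rfl
          change _ ↔ ∃ y ∈ (c.map _).roots, _
          rw [Forest.roots_map]
          simp only [Finset.mem_biUnion, hun hc', mem_foldr_union, List.mem_map]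
          constructor
          · rintro ⟨p, ⟨y, hy, hp⟩, hq⟩
            exact ⟨_, ⟨y, hy, rfl⟩, Finset.mem_biUnion.2 ⟨p, hp, hq⟩⟩
          · rintro ⟨_, ⟨y, hy, rfl⟩, hq⟩
            obtain ⟨p, hp, hq⟩ := Finset.mem_biUnion.1 hq
            exact ⟨p, ⟨y, hy, hp⟩, hq⟩
        · rintro m ⟨⟩
          exact hN x (by simp [Forest.nodes])
        · intro y hy m hm
          change y ∈ (c.map _).roots at hy
          rw [Forest.roots_map] at hy
          obtain ⟨z, hz, rfl⟩ := List.mem_map.1 hy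
          obtain rfl : z.name = m := by simpa using hm
          rcases hnc.roots_some z hz with h | h
          · exact Or.inl h
          · exact Or.inr ⟨x.name, rfl, by rw [h, hx]⟩
      all_goals simp [Forest.nodes, hy]

/-! #### Expansion -/

theorem Streett.move_subset (α : List (Fin k)) (s : Finset Q) (i : WithBot (Fin k)) :
    (A.move α s i).1 ⊆ s := by
  match i with
  | none => exact Finset.empty_subset _
  | some i =>
    simp only [Streett.move]
    split_ifs <;> exact Finset.inter_subset_left

theorem Streett.move_idx (α : List (Fin k)) (s : Finset Q) (i : WithBot (Fin k))
    (hi : i = ⊥ ∨ ∃ j ∈ A.Mini α, i = (j : WithBot (Fin k))) :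
    (A.move α s i).2 = ⊥ ∨ ∃ j ∈ A.Mini α, (A.move α s i).2 = (j : WithBot (Fin k)) := by
  match i, hi with
  | none, _ => exact Or.inl rfl
  | some i, hi =>
    simp only [Streett.move]
    split_ifs
    · cases h : ((A.Mini α).filter (· < i)).max with
      | bot => exact Or.inl rfl
      | coe j => exact Or.inr ⟨j, (Finset.mem_filter.1 (Finset.mem_of_max h)).1, rfl⟩
    · rcases hi with hi | ⟨j, hj, hi⟩
      · cases hi
      · exact Or.inr ⟨j, hj, hi⟩

theorem mem_roots_insertChild (x z : Work Q k) : ∀ f : Forest (Work Q k),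
    z ∈ (insertChild x f).roots ↔ z = x ∨ z ∈ f.roots
  | .nil => by simp [insertChild, Forest.roots]
  | .cons y c r => by
      unfold insertChild
      split_ifs
      · simp [Forest.roots]
      · simp only [Forest.roots, List.mem_cons, mem_roots_insertChild x z r]
        tauto

theorem mem_roots_insertChildren (z : Work Q k) : ∀ (l : List (Work Q k)) (f : Forest (Work Q k)),
    z ∈ (insertChildren l f).roots ↔ z ∈ l ∨ z ∈ f.roots
  | [], f => by simp [insertChildren]
  | x :: l, f => by
      change z ∈ (insertChildren l (insertChild x f)).roots ↔ _
      rw [mem_roots_insertChildren z l, mem_roots_insertChild, List.mem_cons]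
      tauto

/-- A childless node created by expansion. -/
def Streett.Fresh (α : List (Fin k)) (x : Work Q k) : Prop :=
  (x.idx = ⊥ ∨ ∃ i ∈ A.Mini α, x.idx = (i : WithBot (Fin k))) ∧ x.old = none ∧ x.merged = false

theorem Streett.sound_insertChild {μ N : ℕ} {α : List (Fin k)} {x : Work Q k}
    (hx : A.Fresh α x) : ∀ {f : Forest (Work Q k)},
      f.All (fun α x cs rs => A.Sound μ N α x cs rs ∧ x.merged = false) α →
      (insertChild x f).All (fun α x cs rs => A.Sound μ N α x cs rs ∧ x.merged = false) α
  | .nil, _ => ⟨⟨⟨hx.1, by simp [Forest.roots], by simp [Forest.roots], by simp [hx.2.1],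
      by simp [Forest.roots]⟩, hx.2.2⟩, trivial, trivial⟩
  | .cons y c r, hf => by
      unfold insertChild
      split_ifs with h
      · refine ⟨⟨⟨hx.1, ?_, by simp [Forest.roots], by simp [hx.2.1],
          by simp [Forest.roots]⟩, hx.2.2⟩, trivial, hf⟩
        intro z hz
        rcases List.mem_cons.1 hz with rfl | hz
        exacts [h.le, (hf.1.1.sorted z hz).trans h.le]
      · refine ⟨⟨⟨hf.1.1.idx, ?_, hf.1.1.union, hf.1.1.range, hf.1.1.link⟩, hf.1.2⟩,
          hf.2.1, Streett.sound_insertChild hx hf.2.2⟩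
        intro z hz
        rcases (mem_roots_insertChild _ _ _).1 hz with rfl | hz
        exacts [not_lt.1 h, hf.1.1.sorted z hz]

theorem Streett.sound_insertChildren {μ N : ℕ} {α : List (Fin k)} :
    ∀ {l : List (Work Q k)} {f : Forest (Work Q k)}, (∀ x ∈ l, A.Fresh α x) →
      f.All (fun α x cs rs => A.Sound μ N α x cs rs ∧ x.merged = false) α →
      (insertChildren l f).All (fun α x cs rs => A.Sound μ N α x cs rs ∧ x.merged = false) α
  | [], _, _, hf => hf
  | x :: l, _, hl, hf =>
      Streett.sound_insertChildren (l := l) (fun y hy => hl y (List.mem_cons_of_mem _ hy))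
        (A.sound_insertChild (hl x List.mem_cons_self) hf)

theorem Streett.fresh_of_mem {μ N : ℕ} {α : List (Fin k)} {R : Finset Q} :
    ∀ {f : Forest (Work Q k)}, f.All (fun α x cs rs => A.Sound μ N α x cs rs ∧ x.merged = false) α →
      ∀ x ∈ A.fresh α R f, A.Fresh α x
  | .nil, _, x, hx => by simp [Streett.fresh] at hx
  | .cons y c r, hf, x, hx => by
      unfold Streett.fresh at hx
      simp only at hx
      split_ifs at hx
      · rcases List.mem_cons.1 hx with rfl | hx
        · exact ⟨A.move_idx _ _ _ hf.1.1.idx, rfl, rfl⟩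
        · exact Streett.fresh_of_mem hf.2.2 x hx
      · exact Streett.fresh_of_mem hf.2.2 x hx

theorem Streett.exists_of_mem_roots_stay {α : List (Fin k)} {R : Finset Q} :
    ∀ {f : Forest (Work Q k)}, ∀ y ∈ (A.stay α R f).roots,
      ∃ x ∈ f.roots, y.idx = x.idx ∧ y.old = x.old
  | .nil, y, hy => by simp [Streett.stay, Forest.roots] at hy
  | .cons x c r, y, hy => by
      rcases List.mem_cons.1 hy with rfl | hy
      · exact ⟨x, List.mem_cons_self, rfl, rfl⟩
      · obtain ⟨z, hz, h⟩ := Streett.exists_of_mem_roots_stay y hy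
        exact ⟨z, List.mem_cons_of_mem _ hz, h⟩

/-- Expansion moves states between siblings and loses none: what leaves a child reappears in a new
sibling. As `R` is what the parent itself has lost, the parent's set remains the union of its
children's sets. -/
theorem Streett.mem_stay_or_fresh {α : List (Fin k)} {R : Finset Q} (q : Q) :
    ∀ f : Forest (Work Q k),
      (∃ y, (y ∈ A.fresh α R f ∨ y ∈ (A.stay α R f).roots) ∧ q ∈ y.set) ↔
        (∃ x ∈ f.roots, q ∈ x.set) ∧ q ∉ R
  | .nil => by simp [Streett.stay, Streett.fresh, Forest.roots]
  | .cons x c r => by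
      have ih := Streett.mem_stay_or_fresh (α := α) (R := R) q r
      have hm := A.move_subset α (x.set \ R) x.idx
      have hf : (∃ y ∈ A.fresh α R (.cons x c r), q ∈ y.set) ↔
          q ∈ (A.move α (x.set \ R) x.idx).1 ∨ ∃ y ∈ A.fresh α R r, q ∈ y.set := by
        rw [Streett.fresh]
        split_ifs with h
        · simp
        · rw [Finset.not_nonempty_iff_eq_empty] at h
          simp [h]
      have e : (∃ y, (y ∈ A.fresh α R (.cons x c r) ∨ y ∈ (A.stay α R (.cons x c r)).roots) ∧
          q ∈ y.set) ↔ (∃ y ∈ A.fresh α R (.cons x c r), q ∈ y.set) ∨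
            q ∈ x.set \ (R ∪ (A.move α (x.set \ R) x.idx).1) ∨
            ∃ y ∈ (A.stay α R r).roots, q ∈ y.set := by
        simp only [Streett.stay, Forest.roots, List.mem_cons, or_and_right, exists_or,
          exists_eq_left]
      rw [e, hf]
      simp only [or_and_right, exists_or] at ih
      have hm' := @hm q
      simp only [Forest.roots, List.mem_cons, or_and_right, exists_or, exists_eq_left,
        Finset.mem_sdiff, Finset.mem_union] at ih hm' ⊢
      -- `M`: `q` leaves `x`; `X`: `q` lies in `x`; `F`, `S`, `T`: `q` lies in a fresh, a remaining,
      -- an original node stemming from the siblings to the right.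
      have key : ∀ F S M X R T : Prop, (F ∨ S ↔ T ∧ ¬ R) → (M → X ∧ ¬ R) →
          ((M ∨ F) ∨ (X ∧ ¬ (R ∨ M)) ∨ S ↔ X ∧ ¬ R ∨ T ∧ ¬ R) := by
        clear * -
        intro F S M X R T h1 h2
        by_cases hR : R <;> by_cases hM : M <;> simp_all
        rw [← h1, or_left_comm]
      exact key _ _ _ _ _ _ ih hm'

theorem Streett.sound_stay {μ N : ℕ} :
    ∀ {α : List (Fin k)} {R : Finset Q} {f : Forest (Work Q k)},
      f.All (fun α x cs rs => A.Sound μ N α x cs rs ∧ x.merged = false) α →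
      (A.stay α R f).All (fun α x cs rs => A.Sound μ N α x cs rs ∧ x.merged = false) α
  | _, _, .nil, _ => trivial
  | α, R, .cons x c r, hf => by
      refine ⟨⟨⟨hf.1.1.idx, ?_, ?_, hf.1.1.range, ?_⟩, hf.1.2⟩,
        A.sound_insertChildren (A.fresh_of_mem hf.2.1) (Streett.sound_stay hf.2.1),
        Streett.sound_stay hf.2.2⟩
      · intro y hy
        obtain ⟨z, hz, h, -⟩ := A.exists_of_mem_roots_stay y hy
        exact h.trans_le (hf.1.1.sorted z hz)
      · intro hc q
        have hc' : c.roots ≠ [] := by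
          intro h
          rw [Forest.roots_eq_nil] at h
          subst h
          exact hc rfl
        simp only [mem_roots_insertChildren]
        rw [A.mem_stay_or_fresh, Finset.mem_sdiff, hf.1.1.union hc' q]
      · intro y hy m hm
        rcases (mem_roots_insertChildren _ _ _).1 hy with hy | hy
        · rw [(A.fresh_of_mem hf.2.1 y hy).2.1] at hm
          cases hm
        · obtain ⟨z, hz, -, h⟩ := A.exists_of_mem_roots_stay y hy
          exact hf.1.1.link z hz m (h ▸ hm)

/-! #### Horizontal merge -/

/-- The last clause says that a surviving occurrence has beaten all siblings on its left; together
with the second half of `lost` this makes siblings disjoint. -/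
theorem exists_of_mem_roots_hMerge {R : Finset Q} :
    ∀ {l : List (Work Q k)} {f : Forest (Work Q k)}, ∀ y ∈ (hMerge R l f).roots,
      ∃ x ∈ f.roots, y.idx = x.idx ∧ y.old = x.old ∧ y.set ⊆ x.set \ R ∧
        ∀ q ∈ y.set, ∀ z ∈ l, q ∈ z.set → x.idx < z.idx
  | _, .nil, y, hy => by simp [hMerge, Forest.roots] at hy
  | l, .cons x c r, y, hy => by
      rcases List.mem_cons.1 hy with rfl | hy
      · refine ⟨x, List.mem_cons_self, rfl, rfl,
          Finset.sdiff_subset_sdiff subset_rfl Finset.subset_union_left, fun q hq z hz hqz => ?_⟩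
        by_contra hlt
        simp only [Finset.mem_sdiff, Finset.mem_union, Finset.mem_filter] at hq
        exact hq.2 (Or.inr ⟨hq.1, Or.inl ⟨z, hz, hqz, not_lt.1 hlt⟩⟩)
      · obtain ⟨z, hz, h1, h2, h3, h4⟩ := exists_of_mem_roots_hMerge y hy
        exact ⟨z, List.mem_cons_of_mem _ hz, h1, h2, h3,
          fun q hq w hw => h4 q hq w (List.mem_append_left _ hw)⟩

/-- The occurrence of `q` with least index, leftmost among ties, survives. The hypothesis on `l`
carries through the induction a candidate not yet passed that beats everything passed so far: either
the current node wins, or a candidate beating it too lies further right. -/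
theorem mem_hMerge_of_mem {R : Finset Q} {q : Q} (hq : q ∉ R) :
    ∀ {l : List (Work Q k)} {f : Forest (Work Q k)} (x : Work Q k), x ∈ f.roots → q ∈ x.set →
      (∀ z ∈ l, q ∈ z.set → x.idx < z.idx) → ∃ y ∈ (hMerge R l f).roots, q ∈ y.set
  | _, .nil, x, hx, _, _ => by simp [Forest.roots] at hx
  | l, .cons v c r, x, hx, hqx, hl => by
      have key : (∃ x ∈ r.roots, q ∈ x.set ∧ ∀ z ∈ l ++ [v], q ∈ z.set → x.idx < z.idx) →
          ∃ y ∈ (hMerge R l (.cons v c r)).roots, q ∈ y.set := by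
        rintro ⟨x, hx, hqx, h⟩
        obtain ⟨y, hy, h⟩ := mem_hMerge_of_mem hq x hx hqx h
        exact ⟨y, List.mem_cons_of_mem _ hy, h⟩
      by_cases hv : q ∈ v.set
      · by_cases hlost : (∃ y ∈ l, q ∈ y.set ∧ y.idx ≤ v.idx) ∨
            (∃ y ∈ r.roots, q ∈ y.set ∧ y.idx < v.idx)
        · apply key
          have ht : x.idx < v.idx → ∃ x ∈ r.roots, q ∈ x.set ∧
              ∀ z ∈ l ++ [v], q ∈ z.set → x.idx < z.idx := by
            intro hxv
            have hxr : x ∈ r.roots := by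
              rcases List.mem_cons.1 hx with rfl | hx
              exacts [absurd hxv (lt_irrefl _), hx]
            refine ⟨x, hxr, hqx, fun z hz hqz => ?_⟩
            rcases List.mem_append.1 hz with hz | hz
            · exact hl z hz hqz
            · rwa [List.mem_singleton.1 hz]
          rcases hlost with ⟨y, hy, hqy, hle⟩ | ⟨y, hy, hqy, hlt⟩
          · exact ht ((hl y hy hqy).trans_le hle)
          · rcases lt_or_ge x.idx v.idx with h | h
            · exact ht h
            · refine ⟨y, hy, hqy, fun z hz hqz => ?_⟩
              rcases List.mem_append.1 hz with hz | hz
              · exact (hlt.trans_le h).trans (hl z hz hqz)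
              · rwa [List.mem_singleton.1 hz]
        · refine ⟨_, List.mem_cons_self, ?_⟩
          simp only [Finset.mem_sdiff, Finset.mem_union, Finset.mem_filter]
          exact ⟨hv, fun h => h.elim hq fun h => hlost h.2⟩
      · apply key
        have hxr : x ∈ r.roots := by
          rcases List.mem_cons.1 hx with rfl | hx
          exacts [absurd hqx hv, hx]
        refine ⟨x, hxr, hqx, fun z hz hqz => ?_⟩
        rcases List.mem_append.1 hz with hz | hz
        · exact hl z hz hqz
        · rw [List.mem_singleton.1 hz] at hqz
          exact absurd hqz hv

theorem Streett.sound_hMerge {μ N : ℕ} :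
    ∀ {α : List (Fin k)} {R : Finset Q} {l : List (Work Q k)} {f : Forest (Work Q k)},
      f.All (fun α x cs rs => A.Sound μ N α x cs rs ∧ x.merged = false) α →
      (hMerge R l f).All (fun α x cs rs => A.Sound μ N α x cs rs ∧ x.merged = false ∧
        ∀ y ∈ rs, Disjoint x.set y.set) α
  | _, _, _, .nil, _ => trivial
  | α, R, l, .cons x c r, hf => by
      refine ⟨⟨⟨hf.1.1.idx, ?_, ?_, hf.1.1.range, ?_⟩, hf.1.2, ?_⟩, Streett.sound_hMerge hf.2.1,
        Streett.sound_hMerge hf.2.2⟩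
      · intro y hy
        obtain ⟨z, hz, h, -⟩ := exists_of_mem_roots_hMerge y hy
        exact h.trans_le (hf.1.1.sorted z hz)
      · intro hc q
        have hc' : c.roots ≠ [] := by
          intro h
          rw [Forest.roots_eq_nil] at h
          subst h
          exact hc rfl
        rw [Finset.mem_sdiff, hf.1.1.union hc' q]
        constructor
        · rintro ⟨⟨y, hy, hqy⟩, hq⟩
          exact mem_hMerge_of_mem hq y hy hqy (by simp)
        · rintro ⟨y, hy, hqy⟩
          obtain ⟨z, hz, -, -, h, -⟩ := exists_of_mem_roots_hMerge y hy
          have := Finset.mem_sdiff.1 (h hqy)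
          exact ⟨⟨z, hz, this.1⟩, this.2⟩
      · intro y hy m hm
        obtain ⟨z, hz, -, h, -⟩ := exists_of_mem_roots_hMerge y hy
        exact hf.1.1.link z hz m (h ▸ hm)
      · intro y hy
        obtain ⟨z, hz, h1, -, h3, h4⟩ := exists_of_mem_roots_hMerge y hy
        rw [Finset.disjoint_left]
        intro q hqx hqy
        simp only [Finset.mem_sdiff, Finset.mem_union, Finset.mem_filter] at hqx
        have hlt := h4 q hqy x (by simp) hqx.1
        exact hqx.2 (Or.inr ⟨hqx.1, Or.inr ⟨z, hz, (Finset.mem_sdiff.1 (h3 hqy)).1, hlt⟩⟩)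

/-! #### Removal of empty nodes -/

theorem mem_roots_dropEmpty (y : Work Q k) :
    ∀ f : Forest (Work Q k), y ∈ (dropEmpty f).roots ↔ y ∈ f.roots ∧ y.set.Nonempty
  | .nil => by simp [dropEmpty, Forest.roots]
  | .cons x c r => by
      unfold dropEmpty
      split_ifs with h
      · rw [mem_roots_dropEmpty y r]
        simp only [Forest.roots, List.mem_cons, or_and_right]
        refine (or_iff_right ?_).symm
        rintro ⟨rfl, h'⟩
        exact h'.ne_empty h
      · simp only [Forest.roots, List.mem_cons, or_and_right, mem_roots_dropEmpty y r]
        refine or_congr_left ⟨?_, fun h => h.1⟩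
        rintro rfl
        exact ⟨rfl, Finset.nonempty_iff_ne_empty.2 h⟩

theorem Streett.sound_dropEmpty {μ N : ℕ} :
    ∀ {α : List (Fin k)} {f : Forest (Work Q k)},
      f.All (fun α x cs rs => A.Sound μ N α x cs rs ∧ x.merged = false ∧
        ∀ y ∈ rs, Disjoint x.set y.set) α →
      (dropEmpty f).All (fun α x cs rs => A.Sound μ N α x cs rs ∧ x.merged = false ∧
        (∀ y ∈ rs, Disjoint x.set y.set) ∧ x.set.Nonempty) α
  | _, .nil, _ => trivial
  | α, .cons x c r, hf => by
      unfold dropEmpty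
      split_ifs with h
      · exact Streett.sound_dropEmpty hf.2.2
      · refine ⟨⟨⟨hf.1.1.idx, ?_, ?_, hf.1.1.range, ?_⟩, hf.1.2.1, ?_,
          Finset.nonempty_iff_ne_empty.2 h⟩, Streett.sound_dropEmpty hf.2.1,
          Streett.sound_dropEmpty hf.2.2⟩
        · exact fun y hy => hf.1.1.sorted y ((mem_roots_dropEmpty _ _).1 hy).1
        · intro hc q
          have hc' : c.roots ≠ [] := by
            intro h
            rw [Forest.roots_eq_nil] at h
            subst h
            exact hc rfl
          rw [hf.1.1.union hc' q]
          refine exists_congr fun y => ?_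
          rw [mem_roots_dropEmpty]
          exact ⟨fun h => ⟨⟨h.1, q, h.2⟩, h.2⟩, fun h => ⟨h.1.1, h.2⟩⟩
        · exact fun y hy => hf.1.1.link y ((mem_roots_dropEmpty _ _).1 hy).1
        · exact fun y hy => hf.1.2.2 y ((mem_roots_dropEmpty _ _).1 hy).1

/-! #### Vertical merge -/

theorem exists_of_mem_roots_vMerge :
    ∀ {f : Forest (Work Q k)}, ∀ y ∈ (vMerge f).roots,
      ∃ x ∈ f.roots, y.idx = x.idx ∧ y.old = x.old ∧ y.set = x.set
  | .nil, y, hy => by simp [vMerge, Forest.roots] at hy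
  | .cons x c r, y, hy => by
      unfold vMerge at hy
      split_ifs at hy <;> rcases List.mem_cons.1 hy with rfl | hy
      · exact ⟨x, List.mem_cons_self, rfl, rfl, rfl⟩
      · obtain ⟨z, hz, h⟩ := exists_of_mem_roots_vMerge y hy
        exact ⟨z, List.mem_cons_of_mem _ hz, h⟩
      · exact ⟨y, List.mem_cons_self, rfl, rfl, rfl⟩
      · obtain ⟨z, hz, h⟩ := exists_of_mem_roots_vMerge y hy
        exact ⟨z, List.mem_cons_of_mem _ hz, h⟩

theorem exists_mem_roots_vMerge :
    ∀ {f : Forest (Work Q k)}, ∀ x ∈ f.roots,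
      ∃ y ∈ (vMerge f).roots, y.set = x.set
  | .nil, y, hy => by simp [Forest.roots] at hy
  | .cons x c r, y, hy => by
      unfold vMerge
      rcases List.mem_cons.1 hy with rfl | hy
      · split_ifs
        · exact ⟨_, List.mem_cons_self, rfl⟩
        · exact ⟨_, List.mem_cons_self, rfl⟩
      · obtain ⟨z, hz, h⟩ := exists_mem_roots_vMerge y hy
        split_ifs
        · exact ⟨z, List.mem_cons_of_mem _ hz, h⟩
        · exact ⟨z, List.mem_cons_of_mem _ hz, h⟩

/-- What holds at every node after vertical merge. -/
structure Streett.Merged (μ N : ℕ) (α : List (Fin k)) (x : Work Q k) (cs rs : List (Work Q k)) :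
    Prop extends A.Sound μ N α x cs rs where
  disj : ∀ y ∈ rs, Disjoint x.set y.set
  nonempty : x.set.Nonempty
  left : ∀ y ∈ cs.head?, y.idx ≠ ⊥
  new : x.merged = true → ∀ y ∈ cs, y.old = none

theorem Streett.merged_vMerge {μ N : ℕ} :
    ∀ {α : List (Fin k)} {f : Forest (Work Q k)},
      f.All (fun α x cs rs => A.Sound μ N α x cs rs ∧ x.merged = false ∧
        (∀ y ∈ rs, Disjoint x.set y.set) ∧ x.set.Nonempty) α →
      (vMerge f).All (A.Merged μ N) α
  | _, .nil, _ => trivial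
  | α, .cons x c r, hf => by
      have hs : ∀ y ∈ (vMerge r).roots, y.idx ≤ x.idx := by
        intro y hy
        obtain ⟨z, hz, h, -⟩ := exists_of_mem_roots_vMerge y hy
        exact h.trans_le (hf.1.1.sorted z hz)
      have hd : ∀ y ∈ (vMerge r).roots, Disjoint x.set y.set := by
        intro y hy
        obtain ⟨z, hz, -, -, h⟩ := exists_of_mem_roots_vMerge y hy
        rw [h]
        exact hf.1.2.2.1 z hz
      unfold vMerge
      split_ifs with h
      · exact ⟨⟨⟨hf.1.1.idx, hs, by simp [Forest.roots], hf.1.1.range, by simp [Forest.roots]⟩,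
          hd, hf.1.2.2.2, by simp [Forest.roots], by simp [Forest.roots]⟩, trivial,
          Streett.merged_vMerge hf.2.2⟩
      · have hc : c ≠ .nil := by rintro rfl; exact h (by simp [Forest.roots])
        refine ⟨⟨⟨hf.1.1.idx, hs, ?_, hf.1.1.range, ?_⟩, hd, hf.1.2.2.2, ?_, ?_⟩,
          Streett.merged_vMerge hf.2.1, Streett.merged_vMerge hf.2.2⟩
        · intro _ q
          rw [hf.1.1.union (mt Forest.roots_eq_nil.1 hc) q]
          constructor
          · rintro ⟨y, hy, hq⟩
            obtain ⟨z, hz, h⟩ := exists_mem_roots_vMerge y hy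
            exact ⟨z, hz, h ▸ hq⟩
          · rintro ⟨y, hy, hq⟩
            obtain ⟨z, hz, -, -, h⟩ := exists_of_mem_roots_vMerge y hy
            exact ⟨z, hz, h ▸ hq⟩
        · intro y hy m hm
          obtain ⟨z, hz, -, h, -⟩ := exists_of_mem_roots_vMerge y hy
          exact hf.1.1.link z hz m (h ▸ hm)
        · match c, hc, hf, h with
          | .cons y c' r', _, hf, h =>
            -- Siblings are sorted by decreasing index: were the leftmost index `⊥`, all would be,
            -- and vertical merge would have applied.
            have hy : y.idx ≠ ⊥ := by
              intro hy
              refine h fun z hz => ?_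
              rcases List.mem_cons.1 hz with rfl | hz
              · exact hy
              · exact le_bot_iff.1 (hy ▸ hf.2.1.1.1.sorted z hz)
            unfold vMerge
            split_ifs <;> simpa [Forest.roots] using hy
        · intro hm
          rw [hf.1.2.1] at hm
          cases hm

/-! #### Growing -/

/-- What holds at every node of a tree before naming. -/
structure Streett.Ripe (μ N : ℕ) (α : List (Fin k)) (x : Work Q k) (cs rs : List (Work Q k)) :
    Prop extends A.Merged μ N α x cs rs where
  leaf : cs = [] → A.Mini (ext α x.idx) = ∅

theorem Streett.roots_grow (α : List (Fin k)) :
    ∀ f : Forest (Work Q k), (A.grow α f).roots = f.roots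
  | .nil => by simp [Streett.grow]
  | .cons x .nil r => by simp [Streett.grow, Forest.roots, Streett.roots_grow α r]
  | .cons x (.cons y c r') r => by simp [Streett.grow, Forest.roots, Streett.roots_grow α r]

theorem Streett.mem_roots_spine {s : Finset Q} {α : List (Fin k)} {y : Work Q k}
    (hy : y ∈ (A.spine s α).roots) : y.idx ≠ ⊥ ∧ y.old = none ∧ y.set = s := by
  unfold Streett.spine at hy
  split at hy
  · simp [Forest.roots] at hy
  · obtain rfl : y = _ := by simpa [Forest.roots] using hy
    exact ⟨WithBot.coe_ne_bot, rfl, rfl⟩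

theorem Streett.ripe_spine {μ N : ℕ} {s : Finset Q} (hs : s.Nonempty) (α : List (Fin k)) :
    (A.spine s α).All (A.Ripe μ N) α ∧ (A.spine s α = .nil → A.Mini α = ∅) := by
  unfold Streett.spine
  split
  · next h => exact ⟨trivial, fun _ => Finset.max_eq_bot.1 h⟩
  · next i h =>
    have ih := Streett.ripe_spine (μ := μ) (N := N) hs (α ++ [i])
    refine ⟨⟨⟨⟨⟨?_, by simp [Forest.roots], ?_, by simp, ?_⟩, by simp [Forest.roots], hs, ?_,
      by simp⟩, ?_⟩,
      ih.1, trivial⟩, by simp⟩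
    · exact Or.inr ⟨i, Finset.mem_of_max h, rfl⟩
    · intro hc q
      constructor
      · intro hq
        obtain ⟨y, hy⟩ := List.exists_mem_of_ne_nil _ hc
        exact ⟨y, hy, (A.mem_roots_spine hy).2.2 ▸ hq⟩
      · rintro ⟨y, hy, hq⟩
        exact (A.mem_roots_spine hy).2.2 ▸ hq
    · intro y hy m hm
      rw [(A.mem_roots_spine hy).2.1] at hm
      cases hm
    · exact fun y hy => (A.mem_roots_spine (List.mem_of_mem_head? hy)).1
    · exact fun h => ih.2 (Forest.roots_eq_nil.1 h)
termination_by (Finset.univ \ A.Cover α).card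
decreasing_by exact A.card_uncovered_lt (by assumption)

theorem Streett.ripe_grow {μ N : ℕ} :
    ∀ {α : List (Fin k)} {f : Forest (Work Q k)}, f.All (A.Merged μ N) α →
      (A.grow α f).All (A.Ripe μ N) α
  | _, .nil, _ => by unfold Streett.grow; trivial
  | α, .cons x .nil r, hf => by
      unfold Streett.grow
      have hsp := A.ripe_spine (μ := μ) (N := N) hf.1.nonempty (ext α x.idx)
      refine ⟨⟨⟨⟨hf.1.idx, ?_, ?_, hf.1.range, ?_⟩, ?_, hf.1.nonempty, ?_, ?_⟩, ?_⟩, hsp.1,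
        Streett.ripe_grow hf.2.2⟩
      · rw [A.roots_grow]; exact hf.1.sorted
      · intro hc q
        constructor
        · intro hq
          obtain ⟨y, hy⟩ := List.exists_mem_of_ne_nil _ hc
          exact ⟨y, hy, (A.mem_roots_spine hy).2.2 ▸ hq⟩
        · rintro ⟨y, hy, hq⟩
          exact (A.mem_roots_spine hy).2.2 ▸ hq
      · intro y hy m hm
        rw [(A.mem_roots_spine hy).2.1] at hm
        cases hm
      · rw [A.roots_grow]; exact hf.1.disj
      · exact fun y hy => (A.mem_roots_spine (List.mem_of_mem_head? hy)).1
      · exact fun _ y hy => (A.mem_roots_spine hy).2.1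
      · exact fun h => hsp.2 (Forest.roots_eq_nil.1 h)
  | α, .cons x (.cons y c r') r, hf => by
      unfold Streett.grow
      refine ⟨⟨?_, ?_⟩, Streett.ripe_grow hf.2.1, Streett.ripe_grow hf.2.2⟩
      · rw [A.roots_grow, A.roots_grow]; exact hf.1
      · rw [A.roots_grow]; simp [Forest.roots]

/-- The tree before naming. -/
def Streett.grownStep (t : Forest (Label Q k)) (a : Sym) : Forest (Work Q k) :=
  A.grow [] (vMerge (dropEmpty (hMerge ∅ [] (A.expand (A.subsetStep a t)))))

theorem Streett.ripe_grownStep [Fintype Q] {t : Forest (Label Q k)} (ht : A.IsRSTS t) (a : Sym) :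
    (A.grownStep t a).All (A.Ripe (min (Fintype.card Q) k)
      (Fintype.card Q * (min (Fintype.card Q) k + 1))) [] :=
  A.ripe_grow (A.merged_vMerge (A.sound_dropEmpty (A.sound_hMerge (A.sound_stay
    (A.sound_subsetStep a ht.2.2.1 ht.2.2.2.2.2 ht.2.2.2.2.1)))))

theorem roots_length_hMerge {R : Finset Q} : ∀ {l : List (Work Q k)} {f : Forest (Work Q k)},
    (hMerge R l f).roots.length = f.roots.length
  | _, .nil => rfl
  | l, .cons x c r => by simp [hMerge, Forest.roots, roots_length_hMerge (l := l ++ [x]) (f := r)]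

theorem roots_length_dropEmpty : ∀ {f : Forest (Work Q k)},
    (dropEmpty f).roots.length ≤ f.roots.length
  | .nil => le_rfl
  | .cons x c r => by
      have := roots_length_dropEmpty (f := r)
      unfold dropEmpty
      split_ifs <;> simp [Forest.roots] <;> omega

theorem roots_length_vMerge : ∀ {f : Forest (Work Q k)},
    (vMerge f).roots.length = f.roots.length
  | .nil => rfl
  | .cons x c r => by
      have := roots_length_vMerge (f := r)
      unfold vMerge
      split_ifs <;> simp [Forest.roots] <;> omega

theorem Streett.roots_length_stay {α : List (Fin k)} {R : Finset Q} :
    ∀ {f : Forest (Work Q k)}, (A.stay α R f).roots.length = f.roots.length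
  | .nil => rfl
  | .cons x c r => by simp [Streett.stay, Forest.roots, Streett.roots_length_stay (f := r)]

theorem Streett.roots_grownStep [Fintype Q] {t : Forest (Label Q k)} (ht : A.IsRSTS t) (a : Sym) :
    (A.grownStep t a).roots.length ≤ 1 ∧ ∀ x ∈ (A.grownStep t a).roots, x.idx = ⊥ := by
  unfold Streett.grownStep
  rw [A.roots_grow]
  constructor
  · rw [roots_length_vMerge]
    refine roots_length_dropEmpty.trans ?_
    rw [roots_length_hMerge, Streett.expand, A.roots_length_stay, Streett.subsetStep,
      Forest.roots_map, List.length_map]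
    exact ht.1
  · intro x hx
    obtain ⟨x, hx', h, -⟩ := exists_of_mem_roots_vMerge x hx
    rw [h]
    obtain ⟨x, hx', h, -⟩ := exists_of_mem_roots_hMerge x ((mem_roots_dropEmpty _ _).1 hx').1
    rw [h]
    obtain ⟨x, hx', h, -⟩ := A.exists_of_mem_roots_stay x hx'
    rw [h]
    rw [Streett.subsetStep, Forest.roots_map] at hx'
    obtain ⟨y, hy, rfl⟩ := List.mem_map.1 hx'
    exact ht.2.1 y hy

end Invariants

end StreettDet

namespace StreettDet

/-! ### Codes of trees -/

section Codes

set_option linter.unusedSectionVars false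

variable {Sym Q : Type*} {k : ℕ}

/-- The bucket and the colour weight of a left spine, the depth at which its head is attached, and
whether the index label of its head is `0`. -/
abbrev SpineCode := (ℕ × ℕ) × ℕ × Bool

/-- The code of a leaf: its state label, its `L_h^→`, and the code of its left spine. -/
abbrev LeafCode (Q : Type*) (k : ℕ) := Finset Q × List (Fin k) × SpineCode

/-- The colour of the `i`-th node of a left spine of weight `w`: each yellow node contributes `2`
to the weight, a green node `1`, and they precede the red nodes in this order. -/
def colorOf (w i : ℕ) : Color :=
  if 2 * i ≤ w then .yellow else if 2 * i = w + 1 then .green else .red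

variable [DecidableEq Q] (A : Streett Sym Q k)

/-- `L` is a code of the forest of children of a node at depth `d` with `L_h^→ = α`.  With
`some (σ, i)`, the leftmost root is the `i`-th node of a left spine with code `σ`. -/
def Streett.Coded (μ : ℕ) : ℕ → List (Fin k) → Option (SpineCode × ℕ) → Forest (Label Q k) →
    List (LeafCode Q k) → Prop
  | _, _, _, .nil, L => L = []
  | d, α, s, .cons x c r, L => ∃ (σ : SpineCode) (i : ℕ) (L₁ L₂ : List (LeafCode Q k)),
      (s = some (σ, i) ∧ x.idx ≠ ⊥ ∨
        s = none ∧ σ.2.1 = d ∧ i = 1 ∧ (σ.2.2 = true ↔ x.idx = ⊥)) ∧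
      x.name = nameOf μ σ.1.1 i ∧ x.color = colorOf σ.1.2 i ∧ L = L₁ ++ L₂ ∧
      (c = .nil ∧ A.Mini (ext α x.idx) = ∅ ∧ L₁ = [(x.set, ext α x.idx, σ)] ∨
        c ≠ .nil ∧ A.Mini (ext α x.idx) ≠ ∅ ∧ (∀ q, q ∈ x.set ↔ ∃ y ∈ c.roots, q ∈ y.set) ∧
        Streett.Coded μ (d + 1) (ext α x.idx) (some (σ, i + 1)) c L₁) ∧
      Streett.Coded μ d α none r L₂

theorem exists_ext_eq_append (α : List (Fin k)) (i : WithBot (Fin k)) : ∃ l, ext α i = α ++ l :=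
  match i with
  | none => ⟨[], (List.append_nil α).symm⟩
  | some j => ⟨[j], rfl⟩

variable {A} {μ : ℕ}

/-- The first leaf ends the spine through the leftmost root; every other leaf ends a spine whose
head lies in this forest, at depth `d` or deeper. -/
theorem Streett.Coded.shape : ∀ {f : Forest (Label Q k)} {d : ℕ} {α : List (Fin k)}
    {s : Option (SpineCode × ℕ)} {L : List (LeafCode Q k)}, A.Coded μ d α s f L → f ≠ .nil →
    ∃ S l σ T, L = (S, α ++ l, σ) :: T ∧ (∀ e ∈ T, d ≤ e.2.2.2.1) ∧
      (s = none → σ.2.1 = d) ∧ ∀ σ' i, s = some (σ', i) → σ = σ'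
  | .nil, _, _, _, _, _, h => absurd rfl h
  | .cons x c r, d, α, s, L, h, _ => by
      obtain ⟨σ, i, L₁, L₂, hs, -, -, rfl, hc, hr⟩ := h
      have h2 : ∀ e ∈ L₂, d ≤ e.2.2.2.1 := by
        by_cases hn : r = .nil
        · subst hn
          obtain rfl : L₂ = [] := hr
          simp
        · obtain ⟨S, l, σ', T, rfl, hT, hσ, -⟩ := hr.shape hn
          intro e he
          rcases List.mem_cons.1 he with rfl | he
          exacts [(hσ rfl).ge, hT e he]
      have hs' : (s = none → σ.2.1 = d) ∧ ∀ σ' i, s = some (σ', i) → σ = σ' := by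
        rcases hs with ⟨rfl, -⟩ | ⟨rfl, h, -⟩
        · refine ⟨by simp, ?_⟩
          rintro σ' i ⟨⟩
          rfl
        · exact ⟨fun _ => h, by simp⟩
      obtain ⟨l, hl⟩ := exists_ext_eq_append α x.idx
      rcases hc with ⟨-, -, rfl⟩ | ⟨hn, -, -, hc⟩
      · exact ⟨x.set, l, σ, L₂, by simp [hl], h2, hs'⟩
      · obtain ⟨S, l', σ', T, rfl, hT, -, hσ⟩ := hc.shape hn
        obtain rfl := hσ _ _ rfl
        refine ⟨S, l ++ l', σ', T ++ L₂, by simp [hl], fun e he => ?_, hs'⟩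
        rcases List.mem_append.1 he with he | he
        exacts [(Nat.le_succ d).trans (hT e he), h2 e he]

/-- The border is just before the first entry that violates `p`. In decoding, `p` says that the head
lies deeper than the current forest. -/
theorem append_inj_of_forall {α : Type*} {p : α → Prop} :
    ∀ {T T' L L' : List α}, T ++ L = T' ++ L' → (∀ e ∈ T, p e) → (∀ e ∈ T', p e) →
      (∀ e ∈ L.head?, ¬ p e) → (∀ e ∈ L'.head?, ¬ p e) → T = T' ∧ L = L'
  | [], [], _, _, h, _, _, _, _ => ⟨rfl, h⟩
  | [], a :: T', L, L', h, _, h2, h3, _ => by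
      simp only [List.nil_append] at h
      subst h
      exact absurd (h2 a List.mem_cons_self) (h3 a (by simp))
  | a :: T, [], L, L', h, h1, _, _, h4 => by
      simp only [List.nil_append] at h
      subst h
      exact absurd (h1 a List.mem_cons_self) (h4 a (by simp))
  | a :: T, b :: T', L, L', h, h1, h2, h3, h4 => by
      simp only [List.cons_append, List.cons.injEq] at h
      obtain ⟨rfl, h⟩ := h
      have := append_inj_of_forall h (fun e he => h1 e (List.mem_cons_of_mem _ he))
        (fun e he => h2 e (List.mem_cons_of_mem _ he)) h3 h4
      exact ⟨by rw [this.1], this.2⟩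

theorem ext_append_inj {α l l' : List (Fin k)} {i i' : WithBot (Fin k)}
    (h : ext α i ++ l = ext α i' ++ l') (hi : i = ⊥ ↔ i' = ⊥) : i = i' := by
  match i, i' with
  | none, none => rfl
  | none, some j => exact absurd (hi.1 rfl) WithBot.coe_ne_bot
  | some j, none => exact absurd (hi.2 rfl) WithBot.coe_ne_bot
  | some j, some j' =>
    simp only [ext, List.append_assoc, List.append_cancel_left_eq, List.cons_append,
      List.cons.injEq] at h
    rw [h.1]

/-- A code determines the forest. -/
theorem Streett.Coded.unique : ∀ {f f' : Forest (Label Q k)} {d : ℕ} {α : List (Fin k)}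
    {s : Option (SpineCode × ℕ)} {L : List (LeafCode Q k)},
    A.Coded μ d α s f L → A.Coded μ d α s f' L → f = f'
  | .nil, .nil, _, _, _, _, _, _ => rfl
  | .nil, .cons x c r, _, _, _, _, h, h' => by
      obtain ⟨S, l, σ, T, rfl, -⟩ := h'.shape (by simp)
      cases (h : _ = [])
  | .cons x c r, .nil, _, _, _, _, h, h' => by
      obtain ⟨S, l, σ, T, rfl, -⟩ := h.shape (by simp)
      cases (h' : _ = [])
  | .cons x c r, .cons x' c' r', d, α, s, L, h, h' => by
      -- After its first entry, the code of the first subtree has only heads deeper than `d`,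
      -- whereas the code of its right siblings starts with a head at depth exactly `d`.
      have key : ∀ {x : Label Q k} {c r : Forest (Label Q k)} {σ : SpineCode} {i : ℕ}
          {L₁ L₂ : List (LeafCode Q k)},
          (c = .nil ∧ A.Mini (ext α x.idx) = ∅ ∧ L₁ = [(x.set, ext α x.idx, σ)] ∨
            c ≠ .nil ∧ A.Mini (ext α x.idx) ≠ ∅ ∧
            (∀ q, q ∈ x.set ↔ ∃ y ∈ c.roots, q ∈ y.set) ∧
            A.Coded μ (d + 1) (ext α x.idx) (some (σ, i + 1)) c L₁) → A.Coded μ d α none r L₂ →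
          (∃ S l T, L₁ = (S, ext α x.idx ++ l, σ) :: T ∧ ∀ e ∈ T, d < e.2.2.2.1) ∧
          ∀ e ∈ L₂.head?, ¬ d < e.2.2.2.1 := by
        intro x c r σ i L₁ L₂ hc hr
        constructor
        · rcases hc with ⟨-, -, rfl⟩ | ⟨hn, -, -, hc⟩
          · exact ⟨x.set, [], [], by simp, by simp⟩
          · obtain ⟨S, l, σ', T, rfl, hT, -, hσ⟩ := hc.shape hn
            obtain rfl := hσ _ _ rfl
            exact ⟨S, l, T, rfl, hT⟩
        · by_cases hn : r = .nil
          · subst hn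
            obtain rfl : L₂ = [] := hr
            simp
          · obtain ⟨S, l, σ', T, rfl, -, hσ, -⟩ := hr.shape hn
            simp [hσ rfl]
      obtain ⟨σ, i, L₁, L₂, hs, hname, hcol, rfl, hc, hr⟩ := h
      obtain ⟨σ', i', L₁', L₂', hs', hname', hcol', hL, hc', hr'⟩ := h'
      obtain ⟨⟨S, l, T, e₁, hT⟩, h₂⟩ := key hc hr
      obtain ⟨⟨S', l', T', e₁', hT'⟩, h₂'⟩ := key hc' hr'
      have hL' := hL
      rw [e₁, e₁'] at hL'
      simp only [List.cons_append, List.cons.injEq, Prod.mk.injEq] at hL'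
      obtain ⟨⟨rfl, hp, hσ⟩, hT2⟩ := hL'
      have hσ : σ = σ' := by ext <;> simp [hσ]
      subst hσ
      obtain ⟨rfl, rfl⟩ := append_inj_of_forall hT2 hT hT' h₂ h₂'
      obtain rfl : L₁ = L₁' := List.append_cancel_right hL
      -- A node that is not a head has nonzero index, and for a head the flag decides; a nonzero
      -- index is then the entry following `α` in the path.
      have hidx : x.idx = x'.idx ∧ i = i' := by
        rcases hs with ⟨rfl, hb⟩ | ⟨rfl, -, rfl, hb⟩ <;>
          rcases hs' with ⟨hs', hb'⟩ | ⟨hs', -, rfl, hb'⟩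
        · simp only [Option.some.injEq, Prod.mk.injEq] at hs'
          exact ⟨ext_append_inj hp (iff_of_false hb hb'), hs'.2⟩
        · cases hs'
        · cases hs'
        · exact ⟨ext_append_inj hp (hb.symm.trans hb'), rfl⟩
      obtain ⟨hidx, rfl⟩ := hidx
      rw [← hidx] at hc'
      -- Both trees have a leaf here or neither does, since this depends on `Mini` of the common
      -- path.
      have hcs : c = c' ∧ x.set = x'.set := by
        rcases hc with ⟨rfl, hm, e⟩ | ⟨hn, hm, hu, hc⟩ <;>
          rcases hc' with ⟨rfl, hm', e'⟩ | ⟨hn', hm', hu', hc'⟩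
        · rw [e] at e'
          simp only [List.cons.injEq, Prod.mk.injEq] at e'
          exact ⟨rfl, e'.1.1⟩
        · exact absurd hm hm'
        · exact absurd hm' hm
        · obtain rfl := hc.unique hc'
          exact ⟨rfl, Finset.ext fun q => (hu q).trans (hu' q).symm⟩
      obtain ⟨rfl, hset⟩ := hcs
      obtain rfl := hr.unique hr'
      have : x = x' := by
        cases x
        cases x'
        simp only at hname hname' hcol hcol' hidx hset
        simp [hname, hname', hcol, hcol', hidx, hset]
      rw [this]

end Codes

end StreettDet

namespace StreettDet

/-! ### Counting paths of minimal extensions -/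

section Paths

variable {Sym Q : Type*} {k : ℕ} [DecidableEq Q] (A : Streett Sym Q k)

theorem Streett.not_mem_cover_of_mem_mini {α : List (Fin k)} {i : Fin k} (hi : i ∈ A.Mini α) :
    ¬ A.B i ⊆ A.seen α :=
  fun h => (Finset.mem_filter.1 hi).2.1 (A.mem_Cover.2 h)

theorem Streett.not_mem_of_mem_mini {α : List (Fin k)} {i : Fin k} (hi : i ∈ A.Mini α) :
    i ∉ α := fun h => A.not_mem_cover_of_mem_mini hi
  (Finset.subset_biUnion_of_mem A.B (List.mem_toFinset.2 h))

theorem Streett.seen_ssubset {α : List (Fin k)} {i : Fin k} (hi : i ∈ A.Mini α) :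
    A.seen α ⊂ A.seen (α ++ [i]) := by
  rw [A.seen_append]
  exact ⟨Finset.subset_union_left, fun h =>
    A.not_mem_cover_of_mem_mini hi (Finset.subset_union_right.trans h)⟩

/-- `l` is a maximal sequence of minimal extensions of `α`. -/
inductive Streett.MaxPath : List (Fin k) → List (Fin k) → Prop
  | nil {α : List (Fin k)} (h : A.Mini α = ∅) : MaxPath α []
  | cons {α l : List (Fin k)} {i : Fin k} (hi : i ∈ A.Mini α) (h : MaxPath (α ++ [i]) l) :
      MaxPath α (i :: l)

/-- Supplies a default path for padding lists of leaves to a common length. -/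
theorem Streett.exists_maxPath (α : List (Fin k)) : ∃ l, A.MaxPath α l := by
  cases h : (A.Mini α).max with
  | bot => exact ⟨[], .nil (Finset.max_eq_bot.1 h)⟩
  | coe i =>
    obtain ⟨l, hl⟩ := Streett.exists_maxPath (α ++ [i])
    exact ⟨i :: l, .cons (Finset.mem_of_max h) hl⟩
termination_by (Finset.univ \ A.Cover α).card
decreasing_by exact A.card_uncovered_lt (by assumption)

variable {A} in
theorem Streett.MaxPath.nodup {α l : List (Fin k)} (h : A.MaxPath α l) (hα : α.Nodup) :
    (α ++ l).Nodup := by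
  induction h with
  | nil => simpa using hα
  | @cons α l i hi h ih =>
    have := ih (hα.append (List.nodup_singleton i)
      (List.disjoint_singleton.2 (A.not_mem_of_mem_mini hi)))
    simpa using this

/-- The maximal sequences of minimal extensions can be counted through `k`. -/
theorem Streett.ncard_maxPath_le_pow :
    {l | A.MaxPath [] l}.Finite ∧ {l | A.MaxPath [] l}.ncard ≤ (k + 1) ^ k := by
  have hlen : ∀ l ∈ {l | A.MaxPath [] l}, l.length ≤ k := fun l hl => by
    simpa using (hl.nodup List.nodup_nil).length_le_card
  -- Entry `i` is read as an option, `none` past the end: `k` positions with `k + 1` values each.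
  have hinj : Set.InjOn (fun (l : List (Fin k)) (i : Fin k) => l[(i : ℕ)]?)
      {l | A.MaxPath [] l} := by
    intro l hl l' hl' h
    refine List.ext_getElem? fun i => ?_
    by_cases hi : i < k
    · exact congrFun h ⟨i, hi⟩
    · rw [List.getElem?_eq_none ((hlen l hl).trans (not_lt.1 hi)),
        List.getElem?_eq_none ((hlen l' hl').trans (not_lt.1 hi))]
  refine ⟨Set.Finite.of_finite_image (Set.toFinite _) hinj, ?_⟩
  rw [← hinj.ncard_image]
  refine (Set.ncard_le_card _).trans ?_
  simp

/-- A weak form of the LYM inequality. -/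
theorem sum_factorial_le {β ι : Type*} [Fintype β] [DecidableEq β] (s : Finset ι)
    (S : ι → Finset β) (hS : ∀ i ∈ s, ∀ j ∈ s, S i ⊆ S j → i = j) :
    ∑ i ∈ s, (Fintype.card β - (S i).card).factorial ≤ (Fintype.card β).factorial := by
  classical
  have hinj : Set.InjOn S s := fun i hi j hj h => hS i hi j hj h.subset
  have hanti : IsAntichain (· ⊆ ·) (s.image S : Set (Finset β)) := by
    rintro _ hx _ hy hne hsub
    obtain ⟨i, hi, rfl⟩ := Finset.mem_image.1 hx
    obtain ⟨j, hj, rfl⟩ := Finset.mem_image.1 hy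
    exact hne (by rw [hS i hi j hj hsub])
  have h := Finset.lubell_yamamoto_meshalkin_inequality_sum_inv_choose (𝕜 := ℚ) hanti
  rw [Finset.sum_image hinj] at h
  have : ((∑ i ∈ s, (Fintype.card β - (S i).card).factorial : ℕ) : ℚ) ≤
      (Fintype.card β).factorial := by
    -- For an `s`-subset of an `r`-set, `r! / r.choose s = s! * (r - s)!`, and the factor `s! ≥ 1`
    -- is dropped.
    calc ((∑ i ∈ s, (Fintype.card β - (S i).card).factorial : ℕ) : ℚ)
        ≤ ∑ i ∈ s, (Fintype.card β).factorial *
          (((Fintype.card β).choose (S i).card : ℚ))⁻¹ := by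
          push_cast
          refine Finset.sum_le_sum fun i _ => ?_
          have hc := Nat.choose_mul_factorial_mul_factorial (Finset.card_le_univ (S i))
          have hpos : (0 : ℚ) < (Fintype.card β).choose (S i).card := by
            exact_mod_cast Nat.choose_pos (Finset.card_le_univ (S i))
          rw [← div_eq_mul_inv, le_div_iff₀ hpos, ← hc]
          have h1 : 1 ≤ (S i).card.factorial := Nat.one_le_iff_ne_zero.2 (Nat.factorial_ne_zero _)
          norm_cast
          calc _ = (Fintype.card β).choose (S i).card * 1 *
                (Fintype.card β - (S i).card).factorial := by ring
            _ ≤ _ := by gcongr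
      _ = (Fintype.card β).factorial *
          ∑ i ∈ s, (((Fintype.card β).choose (S i).card : ℚ))⁻¹ := by rw [Finset.mul_sum]
      _ ≤ _ := mul_le_of_le_one_right (by positivity) h
  exact_mod_cast this

/-- The sets `B i \ A.seen α` with `i` in `Mini α` are an antichain in the complement of `A.seen α`:
a proper inclusion violates minimality, and equality is excluded by the tie-break on indices. So the
LYM inequality applies. -/
theorem Streett.sum_mini_le [Fintype Q] (α : List (Fin k)) :
    ∑ i ∈ A.Mini α, (Fintype.card Q - (A.seen (α ++ [i])).card).factorial ≤
      (Fintype.card Q - (A.seen α).card).factorial := by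
  have hc : Fintype.card {q // q ∉ A.seen α} = Fintype.card Q - (A.seen α).card := by
    rw [Fintype.card_subtype_compl, Fintype.card_coe]
  have := sum_factorial_le (A.Mini α) (fun i => (A.B i).subtype (fun q => q ∉ A.seen α)) ?_
  · rw [hc] at this
    refine le_trans (Finset.sum_le_sum fun i _ => Nat.factorial_le ?_) this
    rw [Finset.card_subtype, A.seen_append, Finset.union_comm, ← Finset.card_sdiff_add_card,
      Finset.sdiff_eq_filter]
    omega
  · intro i hi j hj hsub
    have hsub' : A.B i ∪ A.seen α ⊆ A.B j ∪ A.seen α := by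
      intro q hq
      by_cases h : q ∈ A.seen α
      · exact Finset.mem_union_right _ h
      · have : (⟨q, h⟩ : {q // q ∉ A.seen α}) ∈ (A.B i).subtype (fun q => q ∉ A.seen α) :=
          Finset.mem_subtype.2 ((Finset.mem_union.1 hq).resolve_right h)
        exact Finset.mem_union_left _ (Finset.mem_subtype.1 (hsub this))
    obtain ⟨-, hi0, hi1, hi2⟩ := Finset.mem_filter.1 hi
    obtain ⟨-, hj0, hj1, hj2⟩ := Finset.mem_filter.1 hj
    by_contra hne
    have heq : A.B i ∪ A.seen α = A.B j ∪ A.seen α := by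
      by_contra h
      exact hj1 i hi0 hne (hsub'.ssubset_of_ne h)
    rcases lt_or_gt_of_ne hne with h | h
    · exact hj2 i hi0 h heq
    · exact hi2 j hj0 h heq.symm

/-- Induction on the number of unseen states: sequences are sorted by their first index `i`, and
`sum_mini_le` adds up the factorials bounding the continuations after `i`. -/
theorem Streett.ncard_maxPath_le [Fintype Q] (α : List (Fin k)) :
    {l | A.MaxPath α l}.Finite ∧
      {l | A.MaxPath α l}.ncard ≤ (Fintype.card Q - (A.seen α).card).factorial := by
  by_cases h : A.Mini α = ∅
  · have : {l | A.MaxPath α l} ⊆ {[]} := by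
      rintro l (_ | ⟨hi, _⟩)
      · rfl
      · simp [h] at hi
    refine ⟨(Set.finite_singleton _).subset this, ?_⟩
    refine (Set.ncard_le_ncard this).trans ?_
    rw [Set.ncard_singleton]
    exact Nat.one_le_iff_ne_zero.2 (Nat.factorial_ne_zero _)
  · have hsub : {l | A.MaxPath α l} ⊆
        ⋃ i ∈ A.Mini α, (i :: ·) '' {l | A.MaxPath (α ++ [i]) l} := by
      rintro l (h' | ⟨hi, hl⟩)
      · exact absurd h' h
      · exact Set.mem_biUnion hi ⟨_, hl, rfl⟩
    have ih : ∀ i ∈ A.Mini α, {l | A.MaxPath (α ++ [i]) l}.Finite ∧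
        {l | A.MaxPath (α ++ [i]) l}.ncard ≤
          (Fintype.card Q - (A.seen (α ++ [i])).card).factorial :=
      fun i hi => Streett.ncard_maxPath_le (α ++ [i])
    have hfin : (⋃ i ∈ A.Mini α, (i :: ·) '' {l | A.MaxPath (α ++ [i]) l}).Finite :=
      Set.Finite.biUnion (Finset.finite_toSet _) fun i hi => (ih i hi).1.image _
    refine ⟨hfin.subset hsub, (Set.ncard_le_ncard hsub hfin).trans ?_⟩
    refine (Finset.set_ncard_biUnion_le _ _).trans ?_
    refine (Finset.sum_le_sum fun i hi => ?_).trans (A.sum_mini_le α)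
    exact (Set.ncard_image_le (ih i hi).1).trans (ih i hi).2
termination_by Fintype.card Q - (A.seen α).card
decreasing_by
  have h1 := Finset.card_lt_card (A.seen_ssubset hi)
  have h2 := Finset.card_le_univ (A.seen (α ++ [i]))
  omega

end Paths

end StreettDet

namespace StreettDet

/-! ### Naming and colouring -/

section Naming

set_option linter.unusedSectionVars false

variable {Sym Q : Type*} {k : ℕ}

/-- The state labels of the leaves, from left to right. -/
def leafSets : Forest (Work Q k) → List (Finset Q)
  | .nil => []
  | .cons x .nil r => x.set :: leafSets r
  | .cons _ (.cons y c r') r => leafSets (.cons y c r') ++ leafSets r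

theorem leafSets_cons_of_ne {x : Work Q k} {c r : Forest (Work Q k)} (hc : c ≠ .nil) :
    leafSets (.cons x c r) = leafSets c ++ leafSets r := by
  cases c with
  | nil => exact absurd rfl hc
  | cons y c r' => rw [leafSets]

/-- The number of heads of left spines that have been created by the transition.  The flag tells
whether the leftmost root is the head of a left spine. -/
def newHeads : Bool → Forest (Work Q k) → ℕ
  | _, .nil => 0
  | head, .cons x c r => (if head ∧ x.old = none then 1 else 0) + newHeads false c + newHeads true r

/-- Every left spine has its own leaf, and its head is either old or new. When the leftmost root is
not a head, the leaf of the spine through it remains uncounted, whence the extra `1`. -/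
theorem card_keptBuckets_add_newHeads_le (μ : ℕ) : ∀ (f : Forest (Work Q k)),
    (keptBuckets μ true f).card + newHeads true f ≤ (leafSets f).length ∧
      (f ≠ .nil → (keptBuckets μ false f).card + newHeads false f + 1 ≤ (leafSets f).length)
  | .nil => by simp [keptBuckets, newHeads]
  | .cons x c r => by
      have hr := (card_keptBuckets_add_newHeads_le μ r).1
      have hx : ((x.old.map (bucketOf μ)).toFinset).card + (if x.old = none then 1 else 0) = 1 := by
        cases x.old <;> simp
      have hb : (keptBuckets μ false c).card + newHeads false c + (leafSets r).length + 1 ≤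
          (leafSets (.cons x c r)).length := by
        by_cases hc : c = .nil
        · subst hc
          simp [leafSets, keptBuckets, newHeads]
        · have := (card_keptBuckets_add_newHeads_le μ c).2 hc
          rw [leafSets_cons_of_ne hc, List.length_append]
          omega
      have h1 := Finset.card_union_le
        ((x.old.map (bucketOf μ)).toFinset ∪ keptBuckets μ false c) (keptBuckets μ true r)
      have h2 := Finset.card_union_le
        (x.old.map (bucketOf μ)).toFinset (keptBuckets μ false c)
      have h3 := Finset.card_union_le (∅ ∪ keptBuckets μ false c) (keptBuckets μ true r)
      have h4 := Finset.card_union_le (∅ : Finset ℕ) (keptBuckets μ false c)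
      rw [Finset.card_empty] at h4
      simp only [keptBuckets, newHeads, if_true, true_and, Bool.false_eq_true, false_and, if_false]
      exact ⟨by omega, fun _ => by omega⟩

variable [DecidableEq Q] (A : Streett Sym Q k)

theorem Streett.leafSets_disjoint {μ N : ℕ} : ∀ {α : List (Fin k)} {f : Forest (Work Q k)},
    f.All (A.Ripe μ N) α → (leafSets f).Pairwise Disjoint ∧
      ∀ S ∈ leafSets f, S.Nonempty ∧ ∀ q ∈ S, ∃ y ∈ f.roots, q ∈ y.set
  | _, .nil, _ => by simp [leafSets]
  | α, .cons x c r, hf => by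
      have hr := Streett.leafSets_disjoint hf.2.2
      have key : ∃ l, leafSets (.cons x c r) = l ++ leafSets r ∧ l.Pairwise Disjoint ∧
          ∀ S ∈ l, S.Nonempty ∧ S ⊆ x.set := by
        by_cases hc : c = .nil
        · subst hc
          exact ⟨[x.set], rfl, by simp, by simp [hf.1.nonempty]⟩
        · have ih := Streett.leafSets_disjoint hf.2.1
          refine ⟨_, leafSets_cons_of_ne hc, ih.1, fun S hS => ⟨(ih.2 S hS).1, fun q hq => ?_⟩⟩
          exact (hf.1.union (mt Forest.roots_eq_nil.1 hc) q).2 ((ih.2 S hS).2 q hq)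
      obtain ⟨l, hl, hd, hs⟩ := key
      rw [hl]
      refine ⟨List.pairwise_append.2 ⟨hd, hr.1, fun S hS T hT => ?_⟩, fun S hS => ?_⟩
      · rw [Finset.disjoint_left]
        intro q hqS hqT
        obtain ⟨y, hy, hq⟩ := (hr.2 T hT).2 q hqT
        exact Finset.disjoint_left.1 (hf.1.disj y hy) ((hs S hS).2 hqS) hq
      · rcases List.mem_append.1 hS with hS | hS
        · exact ⟨(hs S hS).1, fun q hq => ⟨x, List.mem_cons_self, (hs S hS).2 hq⟩⟩
        · refine ⟨(hr.2 S hS).1, fun q hq => ?_⟩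
          obtain ⟨y, hy, hq⟩ := (hr.2 S hS).2 q hq
          exact ⟨y, List.mem_cons_of_mem _ hy, hq⟩

theorem length_le_card_of_disjoint [Fintype Q] {l : List (Finset Q)} (h : l.Pairwise Disjoint)
    (hne : ∀ S ∈ l, S.Nonempty) : l.length ≤ Fintype.card Q := by
  have : l.length ≤ (l.foldr (· ∪ ·) ∅).card ∧ ∀ q ∈ l.foldr (· ∪ ·) ∅, ∃ S ∈ l, q ∈ S := by
    induction l with
    | nil => simp
    | cons S l ih =>
      rw [List.pairwise_cons] at h
      obtain ⟨ih1, ih2⟩ := ih h.2 fun S hS => hne S (List.mem_cons_of_mem _ hS)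
      have hd : Disjoint S (l.foldr (· ∪ ·) ∅) := by
        rw [Finset.disjoint_left]
        intro q hq hq'
        obtain ⟨T, hT, hqT⟩ := ih2 q hq'
        exact Finset.disjoint_left.1 (h.1 T hT) hq hqT
      have hS := (hne S List.mem_cons_self).card_pos
      constructor
      · rw [List.foldr_cons, Finset.card_union_of_disjoint hd, List.length_cons]
        omega
      · intro q hq
        rcases Finset.mem_union.1 hq with hq | hq
        · exact ⟨S, List.mem_cons_self, hq⟩
        · obtain ⟨T, hT, hqT⟩ := ih2 q hq
          exact ⟨T, List.mem_cons_of_mem _ hT, hqT⟩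
  exact this.1.trans (Finset.card_le_univ _)

/-! #### Lengths of left spines -/

/-- Every index on the path adds a state to those seen. -/
def Streett.IsPath (α : List (Fin k)) : Prop := α.Nodup ∧ α.length ≤ (A.seen α).card

theorem Streett.isPath_ext {α : List (Fin k)} (h : A.IsPath α) {i : WithBot (Fin k)}
    (hi : i = ⊥ ∨ ∃ j ∈ A.Mini α, i = (j : WithBot (Fin k))) : A.IsPath (ext α i) := by
  rcases hi with rfl | ⟨j, hj, rfl⟩
  · exact h
  · refine ⟨h.1.append (List.nodup_singleton j)
      (List.disjoint_singleton.2 (A.not_mem_of_mem_mini hj)), ?_⟩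
    have := Finset.card_lt_card (A.seen_ssubset hj)
    have h2 := h.2
    change (α ++ [j]).length ≤ (A.seen (α ++ [j])).card
    rw [List.length_append, List.length_singleton]
    omega

variable [Fintype Q]

theorem Streett.IsPath.length_le {A : Streett Sym Q k} {α : List (Fin k)} (h : A.IsPath α) :
    α.length ≤ min (Fintype.card Q) k :=
  le_min (h.2.trans (Finset.card_le_univ _)) (by simpa using h.1.length_le_card)

theorem Streett.isPath_lt {α : List (Fin k)} (h : A.IsPath α) {i : WithBot (Fin k)}
    (hi : i = ⊥ ∨ ∃ j ∈ A.Mini α, i = (j : WithBot (Fin k))) (hne : i ≠ ⊥) :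
    (ext α i).length = α.length + 1 ∧ α.length + 1 ≤ min (Fintype.card Q) k ∧
      (A.seen α).card < (A.seen (ext α i)).card := by
  have := (A.isPath_ext h hi).length_le
  rcases hi with rfl | ⟨j, hj, rfl⟩
  · exact absurd rfl hne
  · have hl : (ext α (j : WithBot (Fin k))).length = α.length + 1 := by
      change (α ++ [j]).length = _
      simp
    exact ⟨hl, hl ▸ this, Finset.card_lt_card (A.seen_ssubset hj)⟩

/-! #### Colours of left spines -/

/-- The leftmost root, as the `i`-th node of a left spine with bucket `b`, and its successors on
the spine get the colours prescribed by the weight `w`. -/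
def ColorsFit (μ b w : ℕ) : ℕ → Forest (Work Q k) → Prop
  | _, .nil => True
  | i, .cons x c _ => (x.finish (nameOf μ b i)).color = colorOf w i ∧ ColorsFit μ b w (i + 1) c

/-- Unchanged names form an initial segment of a spine. For `1 ≤ i ≤ μ`, name number `i + 1` of a
bucket is not `1` modulo `μ + 1`, so by `link` it can only be the successor of the parent's old
name. -/
theorem Streett.Ripe.old_eq {A : Streett Sym Q k} {μ N : ℕ} {α : List (Fin k)} {x z : Work Q k}
    {cs rs : List (Work Q k)} (h : A.Ripe μ N α x cs rs) (hz : z ∈ cs) {b i : ℕ} (hi : 1 ≤ i)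
    (hiμ : i ≤ μ) (ho : z.old = some (nameOf μ b (i + 1))) : x.old = some (nameOf μ b i) := by
  rcases h.link z hz _ ho with ⟨b', hb⟩ | ⟨m, hm, hb⟩
  · exfalso
    unfold nameOf at hb
    have h1 : (μ + 1) * (b - 1) + i = (μ + 1) * b' := by omega
    have h2 : (μ + 1) ∣ i := (Nat.dvd_add_right (dvd_mul_right _ _)).1 (h1 ▸ dvd_mul_right _ _)
    have := Nat.le_of_dvd hi h2
    omega
  · rw [hm]
    unfold nameOf at hb ⊢
    congr 1
    omega

variable {A} in
theorem Streett.Ripe.idx_head {μ N : ℕ} {α : List (Fin k)} {x : Work Q k}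
    {c : Forest (Work Q k)} {rs : List (Work Q k)} (h : A.Ripe μ N α x c.roots rs)
    (hc : c.All (A.Ripe μ N) (ext α x.idx)) {z : Work Q k} (hz : z ∈ c.roots.head?) :
    z.idx ≠ ⊥ ∧ (z.idx = ⊥ ∨ ∃ j ∈ A.Mini (ext α x.idx), z.idx = (j : WithBot (Fin k))) := by
  cases c with
  | nil => simp [Forest.roots] at hz
  | cons y c r =>
    obtain rfl : y = z := by simpa [Forest.roots] using hz
    exact ⟨h.left y hz, hc.1.idx⟩

/-- Below a node that is new or renamed, no node of the spine keeps its name, by `old_eq`; and `w +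
1 < 2 * i` is where `colorOf` turns red. -/
theorem Streett.colorsFit_red {N b w : ℕ} : ∀ {i : ℕ} {α : List (Fin k)} {f : Forest (Work Q k)},
    f.All (A.Ripe (min (Fintype.card Q) k) N) α → A.IsPath α → 1 ≤ i → i ≤ α.length + 2 →
    (∀ z ∈ f.roots.head?, z.idx ≠ ⊥) →
    (∀ z ∈ f.roots.head?, z.old ≠ some (nameOf (min (Fintype.card Q) k) b i)) → w + 1 < 2 * i →
    ColorsFit (min (Fintype.card Q) k) b w i f
  | _, _, .nil, _, _, _, _, _, _, _ => trivial
  | i, α, .cons x c r, hf, hα, hi, hiα, hx, hold, hw => by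
      have hx' := hx x rfl
      obtain ⟨hl, hμ, -⟩ := A.isPath_lt hα hf.1.idx hx'
      have hβ := A.isPath_ext hα hf.1.idx
      refine ⟨?_, Streett.colorsFit_red hf.2.1 hβ (by omega) (by omega) hf.1.left ?_ (by omega)⟩
      · have := hold x rfl
        unfold Work.finish colorOf
        simp only [if_neg this]
        rw [if_neg (by omega), if_neg (by omega)]
      · intro z hz ho
        obtain ⟨hz1, hz2⟩ := hf.1.idx_head hf.2.1 hz
        obtain ⟨-, hμ', -⟩ := A.isPath_lt hβ hz2 hz1
        exact hold x rfl (hf.1.old_eq (List.mem_of_mem_head? hz) hi (by omega) ho)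

/-- The descent continues while nodes are yellow and stops at the first green or red one, below
which all is red. Each node on a spine after the head lengthens the index path, so a spine has at
most `μ + 1` nodes and the weight is at most twice that. -/
theorem Streett.exists_weight {N b : ℕ} : ∀ {c : Forest (Work Q k)} {i : ℕ} {α : List (Fin k)}
    {x : Work Q k} {rs : List (Work Q k)},
    A.Ripe (min (Fintype.card Q) k) N α x c.roots rs →
    c.All (A.Ripe (min (Fintype.card Q) k) N) (ext α x.idx) → A.IsPath (ext α x.idx) → 1 ≤ i →
    i ≤ (ext α x.idx).length + 1 →
    ∃ w, 2 * (i - 1) ≤ w ∧ w ≤ 2 * (min (Fintype.card Q) k + 1) ∧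
      (x.finish (nameOf (min (Fintype.card Q) k) b i)).color = colorOf w i ∧
      ColorsFit (min (Fintype.card Q) k) b w (i + 1) c := by
  intro c i α x rs hx hc hβ hi hiβ
  have hlen := hβ.length_le
  by_cases ho : x.old = some (nameOf (min (Fintype.card Q) k) b i)
  · by_cases hm : x.merged = true
    -- `i - 1` yellow nodes and one green node.
    · refine ⟨2 * i - 1, by omega, by omega, ?_, A.colorsFit_red hc hβ (by omega) (by omega)
        hx.left ?_ (by omega)⟩
      · unfold Work.finish colorOf
        simp only [if_pos ho, if_pos hm]
        rw [if_neg (by omega), if_pos (by omega)]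
      · intro z hz
        rw [hx.new hm z (List.mem_of_mem_head? hz)]
        simp
    · have hy : ∀ w, 2 * i ≤ w →
          (x.finish (nameOf (min (Fintype.card Q) k) b i)).color = colorOf w i := by
        intro w hw
        unfold Work.finish colorOf
        simp only [if_pos ho, if_neg hm, if_pos hw]
      match c, hx, hc with
      | .nil, hx, hc => exact ⟨2 * i, by omega, by omega, hy _ le_rfl, trivial⟩
      | .cons y c r, hx, hc =>
        obtain ⟨hz1, hz2⟩ := hx.idx_head hc (z := y) rfl
        obtain ⟨hl, -, -⟩ := A.isPath_lt hβ hz2 hz1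
        obtain ⟨w, hw1, hw2, hw3, hw4⟩ := Streett.exists_weight (b := b) (i := i + 1) hc.1 hc.2.1
          (A.isPath_ext hβ hz2) (by omega) (by omega)
        exact ⟨w, by omega, hw2, hy w (by omega), hw3, hw4⟩
  · refine ⟨2 * (i - 1), le_rfl, by omega, ?_, A.colorsFit_red hc hβ (by omega) (by omega)
      hx.left ?_ (by omega)⟩
    · unfold Work.finish colorOf
      simp only [if_neg ho]
      rw [if_neg (by omega), if_neg (by omega)]
    · intro z hz ho'
      obtain ⟨hz1, hz2⟩ := hx.idx_head hc hz
      obtain ⟨-, hμ', -⟩ := A.isPath_lt hβ hz2 hz1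
      exact ho (hx.old_eq (List.mem_of_mem_head? hz) hi (by omega) ho')

/-! #### Codes of named trees -/

theorem set_roots_assign (μ : ℕ) (pick : Finset ℕ → ℕ) :
    ∀ (s : Option (ℕ × ℕ)) (U : Finset ℕ) (f : Forest (Work Q k)),
      (assign μ pick s U f).1.roots.map Label.set = f.roots.map Work.set
  | none, _, .nil => rfl
  | some _, _, .nil => rfl
  | none, U, .cons x c r => by
      simp only [assign, Forest.roots, List.map_cons]
      rw [set_roots_assign μ pick none _ r]
      rfl
  | some (b, i), U, .cons x c r => by
      simp only [assign, Forest.roots, List.map_cons]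
      rw [set_roots_assign μ pick none _ r]
      rfl

theorem exists_mem_roots_assign {μ : ℕ} {pick : Finset ℕ → ℕ} {s : Option (ℕ × ℕ)}
    {U : Finset ℕ} {f : Forest (Work Q k)} (q : Q) :
    (∃ y ∈ (assign μ pick s U f).1.roots, q ∈ y.set) ↔ ∃ y ∈ f.roots, q ∈ y.set := by
  have h : ∀ S, S ∈ (assign μ pick s U f).1.roots.map Label.set ↔ S ∈ f.roots.map Work.set := by
    rw [set_roots_assign]
    exact fun _ => Iff.rfl
  simp only [List.mem_map] at h
  constructor
  · rintro ⟨y, hy, hq⟩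
    obtain ⟨z, hz, hzy⟩ := (h _).1 ⟨y, hy, rfl⟩
    exact ⟨z, hz, hzy ▸ hq⟩
  · rintro ⟨y, hy, hq⟩
    obtain ⟨z, hz, hzy⟩ := (h _).2 ⟨y, hy, rfl⟩
    exact ⟨z, hz, hzy ▸ hq⟩

theorem assign_ne_nil {μ : ℕ} {pick : Finset ℕ → ℕ} {s : Option (ℕ × ℕ)}
    {U : Finset ℕ} {f : Forest (Work Q k)} (hf : f ≠ .nil) : (assign μ pick s U f).1 ≠ .nil := by
  intro h
  have := set_roots_assign μ pick s U f
  rw [h] at this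
  have h' : f.roots = [] := by simpa [Forest.roots] using this.symm
  exact hf (Forest.roots_eq_nil.1 h')

/-- The codes of left spines that occur in trees over `n` states. -/
def SpineBound (n μ : ℕ) (σ : SpineCode) : Prop :=
  σ.1.1 ∈ Finset.Icc 1 n ∧ σ.1.2 ≤ 2 * (μ + 1) ∧ σ.2.1 ≤ 2 * n - 2

/-- Requirements on the forest of children of a node whose state label has `m` elements; `s` is as
in `Streett.Coded`. -/
def Fits (n μ m : ℕ) : Option (SpineCode × ℕ) → Forest (Work Q k) → Prop
  | none, f => ∀ y ∈ f.roots, y.set.card + 1 ≤ m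
  | some (σ, i), f => (∀ y ∈ f.roots.head?, y.idx ≠ ⊥ ∧ y.set.card ≤ m) ∧
      (∀ y ∈ f.roots.tail, y.set.card + 1 ≤ m) ∧ ColorsFit μ σ.1.1 σ.1.2 i f ∧ SpineBound n μ σ

/-- A child that is not leftmost misses the states of the leftmost one, which is nonempty; this
strict decrease of cardinality bounds the depth. -/
theorem Streett.fits_children {μ N n : ℕ} {α : List (Fin k)} {x : Work Q k}
    {c : Forest (Work Q k)} {rs : List (Work Q k)} (hx : A.Ripe μ N α x c.roots rs)
    (hc : c.All (A.Ripe μ N) (ext α x.idx)) {σ : SpineCode} {i : ℕ}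
    (hσ : SpineBound n μ σ) (hcol : ColorsFit μ σ.1.1 σ.1.2 i c) :
    Fits n μ x.set.card (some (σ, i)) c := by
  refine ⟨fun y hy => ⟨hx.left y hy, ?_⟩, fun y hy => ?_, hcol, hσ⟩
  · have hy' := List.mem_of_mem_head? hy
    exact Finset.card_le_card fun q hq => (hx.union (List.ne_nil_of_mem hy') q).2 ⟨y, hy', hq⟩
  · match c, hx, hc, hy with
    | .cons z c r, hx, hc, hy =>
      have hu := hx.union (by simp [Forest.roots])
      have hsub : z.set ∪ y.set ⊆ x.set := by
        intro q hq
        rcases Finset.mem_union.1 hq with hq | hq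
        · exact (hu q).2 ⟨z, List.mem_cons_self, hq⟩
        · exact (hu q).2 ⟨y, List.mem_cons_of_mem _ hy, hq⟩
      have h1 := Finset.card_le_card hsub
      rw [Finset.card_union_of_disjoint (hc.1.disj y hy)] at h1
      have h2 := hc.1.nonempty.card_pos
      omega

variable {A} in
theorem Streett.Ripe.seen_lt {μ N : ℕ} {α : List (Fin k)} {x : Work Q k}
    {c : Forest (Work Q k)} {rs : List (Work Q k)} (hx : A.Ripe μ N α x c.roots rs)
    (hc : c.All (A.Ripe μ N) (ext α x.idx)) (hn : c ≠ .nil) :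
    A.Mini (ext α x.idx) ≠ ∅ ∧ (A.seen (ext α x.idx)).card + 1 ≤ Fintype.card Q := by
  match c, hx, hc, hn with
  | .cons y c r, hx, hc, _ =>
    obtain ⟨h1, h2 | ⟨j, hj, -⟩⟩ := hx.idx_head hc (z := y) rfl
    · exact absurd h2 h1
    · exact ⟨Finset.ne_empty_of_mem hj, (Finset.card_lt_card (A.seen_ssubset hj)).trans_le
        (Finset.card_le_univ _)⟩

theorem Streett.maxPath_ext {α l : List (Fin k)} {i : WithBot (Fin k)}
    (hi : i = ⊥ ∨ ∃ j ∈ A.Mini α, i = (j : WithBot (Fin k))) (h : A.MaxPath (ext α i) l) :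
    ∃ l', ext α i ++ l = α ++ l' ∧ A.MaxPath α l' := by
  rcases hi with rfl | ⟨j, hj, rfl⟩
  · exact ⟨l, rfl, h⟩
  · exact ⟨j :: l, by change α ++ [j] ++ l = _; simp, .cons hj h⟩

theorem Streett.card_seen_ext (α : List (Fin k)) (i : WithBot (Fin k)) :
    (A.seen α).card ≤ (A.seen (ext α i)).card := by
  match i with
  | none => exact le_rfl
  | some j =>
    change _ ≤ (A.seen (α ++ [j])).card
    rw [A.seen_append]
    exact Finset.card_le_card Finset.subset_union_left

/-- Naming of the first node of a forest. -/
theorem Streett.exists_assign_cons {N m d : ℕ} {pick : Finset ℕ → ℕ}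
    (hpick : ∀ U ⊂ Finset.Icc 1 (Fintype.card Q), pick U ∈ Finset.Icc 1 (Fintype.card Q))
    {α : List (Fin k)} {s : Option (SpineCode × ℕ)} {U : Finset ℕ}
    {x : Work Q k} {c r : Forest (Work Q k)}
    (hf : (Forest.cons x c r).All (A.Ripe (min (Fintype.card Q) k) N) α) (hα : A.IsPath α)
    (hseen : (A.seen α).card + 1 ≤ Fintype.card Q)
    (hd : d + m ≤ 1 + (A.seen α).card + Fintype.card Q)
    (hs : Fits (Fintype.card Q) (min (Fintype.card Q) k) m s (.cons x c r))
    (hU : U ⊆ Finset.Icc 1 (Fintype.card Q))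
    (hkept : keptBuckets (min (Fintype.card Q) k) s.isNone (.cons x c r) ⊆ U)
    (hcard : U.card + newHeads s.isNone (.cons x c r) ≤ Fintype.card Q) :
    ∃ (σ : SpineCode) (i : ℕ) (V : Finset ℕ),
      assign (min (Fintype.card Q) k) pick (s.map fun p => (p.1.1.1, p.2)) U (.cons x c r) =
        (let c' := assign (min (Fintype.card Q) k) pick (some (σ.1.1, i + 1)) V c
         let r' := assign (min (Fintype.card Q) k) pick none c'.2 r
         (.cons (x.finish (nameOf (min (Fintype.card Q) k) σ.1.1 i)) c'.1 r'.1, r'.2)) ∧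
      (s = some (σ, i) ∧ x.idx ≠ ⊥ ∨
        s = none ∧ σ.2.1 = d ∧ i = 1 ∧ (σ.2.2 = true ↔ x.idx = ⊥)) ∧
      (x.finish (nameOf (min (Fintype.card Q) k) σ.1.1 i)).color = colorOf σ.1.2 i ∧
      ColorsFit (min (Fintype.card Q) k) σ.1.1 σ.1.2 (i + 1) c ∧
      SpineBound (Fintype.card Q) (min (Fintype.card Q) k) σ ∧
      d + 1 + x.set.card ≤ 1 + (A.seen (ext α x.idx)).card + Fintype.card Q ∧
      (∀ y ∈ r.roots, y.set.card + 1 ≤ m) ∧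
      U ⊆ V ∧ V ⊆ Finset.Icc 1 (Fintype.card Q) ∧
      V.card + newHeads false c + newHeads true r ≤
        U.card + newHeads s.isNone (.cons x c r) := by
  match s, hs with
  | some (σ, i), hs =>
    obtain ⟨h1, h2, h3, h4⟩ := hs
    obtain ⟨hx, hxm⟩ := h1 x rfl
    -- This node may have all states of its parent, but its nonzero index adds a seen state, which
    -- pays for the greater depth.
    obtain ⟨-, -, hlt⟩ := A.isPath_lt hα hf.1.idx hx
    refine ⟨σ, i, U, rfl, Or.inl ⟨rfl, hx⟩, h3.1, h3.2, h4, by omega, h2, subset_rfl, hU, ?_⟩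
    simp [newHeads, add_assoc]
  | none, hs =>
    -- For a head, the lost state pays for the greater depth.
    have hxm : x.set.card + 1 ≤ m := hs x List.mem_cons_self
    have hpos := hf.1.nonempty.card_pos
    have hle := A.card_seen_ext α x.idx
    obtain ⟨b, V, hb, hV, hUV, hVc, e⟩ : ∃ b V, b ∈ Finset.Icc 1 (Fintype.card Q) ∧
        V ⊆ Finset.Icc 1 (Fintype.card Q) ∧ U ⊆ V ∧
        V.card + newHeads false c + newHeads true r ≤ U.card + newHeads true (.cons x c r) ∧
        assign (min (Fintype.card Q) k) pick none U (.cons x c r) =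
        (let c' := assign (min (Fintype.card Q) k) pick (some (b, 2)) V c
         let r' := assign (min (Fintype.card Q) k) pick none c'.2 r
         (.cons (x.finish (nameOf (min (Fintype.card Q) k) b 1)) c'.1 r'.1, r'.2)) := by
      cases ho : x.old with
      | some b =>
        have hb : bucketOf (min (Fintype.card Q) k) b ∈ U := hkept (by simp [keptBuckets, ho])
        refine ⟨_, U, hU hb, hU, subset_rfl, ?_, ?_⟩
        · simp [newHeads, ho, add_assoc]
        · simp [assign, ho, Finset.insert_eq_of_mem hb]
      | none =>
        -- This head still awaits a bucket, so `hcard` prevents `U` from being everything.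
        have hlt : U ⊂ Finset.Icc 1 (Fintype.card Q) := by
          refine hU.ssubset_of_ne ?_
          rintro rfl
          simp [newHeads, ho] at hcard
        have hb := hpick U hlt
        refine ⟨_, insert (pick U) U, hb, Finset.insert_subset hb hU, Finset.subset_insert _ _,
          ?_, ?_⟩
        · have := Finset.card_insert_le (pick U) U
          simp only [newHeads, ho, and_self, if_true]
          omega
        · simp [assign, ho]
    obtain ⟨w, -, hw, hw1, hw2⟩ := A.exists_weight (b := b) (i := 1) hf.1 hf.2.1
      (A.isPath_ext hα hf.1.idx) le_rfl (by omega)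
    -- Depth bound: `x.set` is nonempty, so `m ≥ 2`; with at most `n - 1` seen states, `hd` yields
    -- `d ≤ 2n - 2`.
    exact ⟨((b, w), d, decide (x.idx = ⊥)), 1, V, e, Or.inr ⟨rfl, rfl, rfl, by simp⟩, hw1, hw2,
      ⟨hb, hw, by simp only; omega⟩, by omega, fun y hy => hs y (List.mem_cons_of_mem _ hy), hUV,
      hV, hVc⟩

/-- Two budgets run through the induction. The buckets in use plus the new heads still to be named
never exceed `n`. And `d + m ≤ 1 + (A.seen α).card + n` persists, because each step down enlarges
the seen set or shrinks the state set. -/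
theorem Streett.exists_coded {N : ℕ} {pick : Finset ℕ → ℕ}
    (hpick : ∀ U ⊂ Finset.Icc 1 (Fintype.card Q), pick U ∈ Finset.Icc 1 (Fintype.card Q)) :
    ∀ {f : Forest (Work Q k)} {m d : ℕ} {α : List (Fin k)} {s : Option (SpineCode × ℕ)}
      {U : Finset ℕ}, f.All (A.Ripe (min (Fintype.card Q) k) N) α → A.IsPath α →
      (A.seen α).card + 1 ≤ Fintype.card Q → d + m ≤ 1 + (A.seen α).card + Fintype.card Q →
      Fits (Fintype.card Q) (min (Fintype.card Q) k) m s f →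
      U ⊆ Finset.Icc 1 (Fintype.card Q) →
      keptBuckets (min (Fintype.card Q) k) s.isNone f ⊆ U →
      U.card + newHeads s.isNone f ≤ Fintype.card Q →
      (∃ L, A.Coded (min (Fintype.card Q) k) d α s
          (assign (min (Fintype.card Q) k) pick (s.map fun p => (p.1.1.1, p.2)) U f).1 L ∧
        L.map Prod.fst = leafSets f ∧
        ∀ e ∈ L, SpineBound (Fintype.card Q) (min (Fintype.card Q) k) e.2.2 ∧
          ∃ l, e.2.1 = α ++ l ∧ A.MaxPath α l) ∧
      U ⊆ (assign (min (Fintype.card Q) k) pick (s.map fun p => (p.1.1.1, p.2)) U f).2 ∧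
      (assign (min (Fintype.card Q) k) pick (s.map fun p => (p.1.1.1, p.2)) U f).2 ⊆
        Finset.Icc 1 (Fintype.card Q) ∧
      (assign (min (Fintype.card Q) k) pick (s.map fun p => (p.1.1.1, p.2)) U f).2.card ≤
        U.card + newHeads s.isNone f
  | .nil, _, _, _, s, U, _, _, _, _, _, hU, _, _ => by
      have : assign (min (Fintype.card Q) k) pick (s.map fun p => (p.1.1.1, p.2)) U
          (.nil : Forest (Work Q k)) = (.nil, U) := by
        cases s <;> rfl
      rw [this]
      exact ⟨⟨[], rfl, rfl, by simp⟩, subset_rfl, hU, by simp [newHeads]⟩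
  | .cons x c r, m, d, α, s, U, hf, hα, hseen, hd, hs, hU, hkept, hcard => by
      obtain ⟨σ, i, V, e, hσs, hcol, hfit, hσ, hdx, hr, hUV, hV, hVc⟩ :=
        A.exists_assign_cons hpick hf hα hseen hd hs hU hkept hcard
      rw [e]
      have hkc : keptBuckets (min (Fintype.card Q) k) false c ⊆ V := by
        refine (Finset.Subset.trans (fun b hb => ?_) hkept).trans hUV
        simp only [keptBuckets, Finset.mem_union]
        exact Or.inl (Or.inr hb)
      have hkr : keptBuckets (min (Fintype.card Q) k) true r ⊆ V := by
        refine (Finset.Subset.trans (fun b hb => ?_) hkept).trans hUV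
        simp only [keptBuckets, Finset.mem_union]
        exact Or.inr hb
      have hβ := A.isPath_ext hα hf.1.idx
      set c' := assign (min (Fintype.card Q) k) pick (some (σ.1.1, i + 1)) V c with hc'
      have hc : (∃ L, (c = .nil ∧ A.Mini (ext α x.idx) = ∅ ∧ L = [(x.set, ext α x.idx, σ)] ∨
            c ≠ .nil ∧ A.Mini (ext α x.idx) ≠ ∅ ∧ (∀ q, q ∈ x.set ↔ ∃ y ∈ c.roots, q ∈ y.set) ∧
            A.Coded (min (Fintype.card Q) k) (d + 1) (ext α x.idx) (some (σ, i + 1)) c'.1 L) ∧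
          L.map Prod.fst ++ leafSets r = leafSets (.cons x c r) ∧
          ∀ e ∈ L, SpineBound (Fintype.card Q) (min (Fintype.card Q) k) e.2.2 ∧
            ∃ l, e.2.1 = α ++ l ∧ A.MaxPath α l) ∧
          V ⊆ c'.2 ∧ c'.2 ⊆ Finset.Icc 1 (Fintype.card Q) ∧
          c'.2.card ≤ V.card + newHeads false c := by
        by_cases hn : c = .nil
        · subst hn
          have hm := hf.1.leaf rfl
          obtain ⟨l, hl, hp⟩ := A.maxPath_ext hf.1.idx (.nil hm)
          refine ⟨⟨_, Or.inl ⟨rfl, hm, rfl⟩, by simp [leafSets], ?_⟩, subset_rfl, hV, by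
            simp [hc', assign]⟩
          intro e he
          obtain rfl : e = _ := by simpa using he
          exact ⟨hσ, l, by simpa using hl, hp⟩
        · obtain ⟨hmin, hseen'⟩ := hf.1.seen_lt hf.2.1 hn
          obtain ⟨⟨L, hL1, hL2, hL3⟩, h2, h3, h4⟩ := Streett.exists_coded (d := d + 1)
            (s := some (σ, i + 1)) (U := V) hpick
            hf.2.1 hβ hseen' hdx (A.fits_children hf.1 hf.2.1 hσ hfit) hV hkc (by
              change V.card + newHeads false c ≤ _
              omega)
          refine ⟨⟨L, Or.inr ⟨hn, hmin, hf.1.union (mt Forest.roots_eq_nil.1 hn), hL1⟩,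
            by rw [hL2, leafSets_cons_of_ne hn], fun e he => ⟨(hL3 e he).1, ?_⟩⟩, h2, h3, h4⟩
          obtain ⟨l, hl, hp⟩ := (hL3 e he).2
          rw [hl]
          exact A.maxPath_ext hf.1.idx hp
      obtain ⟨⟨L₁, hL₁, hL₁', hL₁''⟩, hVc', hc'n, hc'c⟩ := hc
      obtain ⟨⟨L₂, hL₂, hL₂', hL₂''⟩, h2, h3, h4⟩ := Streett.exists_coded (d := d) (s := none)
        (U := c'.2) hpick hf.2.2 hα hseen hd hr hc'n (hkr.trans hVc') (by
          change c'.2.card + newHeads true r ≤ _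
          omega)
      refine ⟨⟨L₁ ++ L₂, ⟨σ, i, L₁, L₂, hσs, rfl, hcol, rfl, ?_, hL₂⟩, ?_, ?_⟩,
        (hUV.trans hVc').trans h2, h3, ?_⟩
      · rcases hL₁ with ⟨rfl, h⟩ | ⟨hn, hm, hu, h⟩
        · exact Or.inl ⟨rfl, h⟩
        · refine Or.inr ⟨assign_ne_nil hn, hm, fun q => ?_, h⟩
          rw [exists_mem_roots_assign]
          exact hu q
      · rw [List.map_append, hL₂', hL₁']
      · intro e he
        rcases List.mem_append.1 he with he | he
        exacts [hL₁'' e he, hL₂'' e he]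
      · change _ ≤ c'.2.card + newHeads true r at h4
        exact h4.trans (by omega)

end Naming

end StreettDet

namespace StreettDet

/-! ### Counting codes -/

section Counting

set_option linter.unusedSectionVars false

variable {Sym Q : Type*} {k : ℕ} [DecidableEq Q]

/-- Each state is sent to the position of the set containing it, or to `none`. This recovers the
sets and, as they are nonempty, the length of the list. The data are padded with defaults to `m + 1`
positions, the first being separate because the root's spine has fewer choices. -/
theorem ncard_disjoint_lists_le [Fintype Q] {δ : Type*} {m : ℕ} (hQ : Fintype.card Q = m + 1)
    {T₀ T₁ : Finset δ} (h₀ : T₀.Nonempty) (h₁ : T₁.Nonempty) :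
    {L : List (Finset Q × δ) | (L.map Prod.fst).Pairwise Disjoint ∧
      (∀ S ∈ L.map Prod.fst, S.Nonempty) ∧ (∀ e ∈ L.head?, e.2 ∈ T₀) ∧
      ∀ e ∈ L.tail, e.2 ∈ T₁}.Finite ∧
    {L : List (Finset Q × δ) | (L.map Prod.fst).Pairwise Disjoint ∧
      (∀ S ∈ L.map Prod.fst, S.Nonempty) ∧ (∀ e ∈ L.head?, e.2 ∈ T₀) ∧
      ∀ e ∈ L.tail, e.2 ∈ T₁}.ncard ≤ (m + 2) ^ (m + 1) * (T₀.card * T₁.card ^ m) := by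
  classical
  obtain ⟨t₀, ht₀⟩ := h₀
  obtain ⟨t₁, ht₁⟩ := h₁
  set S := {L : List (Finset Q × δ) | (L.map Prod.fst).Pairwise Disjoint ∧
      (∀ S ∈ L.map Prod.fst, S.Nonempty) ∧ (∀ e ∈ L.head?, e.2 ∈ T₀) ∧
      ∀ e ∈ L.tail, e.2 ∈ T₁} with hS
  let T : Fin (m + 1) → Finset δ := Fin.cons T₀ fun _ => T₁
  let t : Fin (m + 1) → δ := Fin.cons t₀ fun _ => t₁
  let φ : List (Finset Q × δ) → Q → Option (Fin (m + 1)) := fun L q =>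
    if h : ∃ j : Fin (m + 1), ∃ e, L[(j : ℕ)]? = some e ∧ q ∈ e.1 then some h.choose else none
  let γ : List (Finset Q × δ) → Fin (m + 1) → δ := fun L j => (L[(j : ℕ)]?.map Prod.snd).getD (t j)
  have hlen : ∀ L ∈ S, L.length ≤ m + 1 := fun L hL => by
    have := length_le_card_of_disjoint hL.1 hL.2.1
    rwa [List.length_map, hQ] at this
  have hφ : ∀ L ∈ S, ∀ (j : Fin (m + 1)) e, L[(j : ℕ)]? = some e →
      ∀ q, φ L q = some j ↔ q ∈ e.1 := by
    intro L hL j e he q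
    constructor
    · intro h
      simp only [φ] at h
      split_ifs at h with h'
      obtain ⟨e', he', hq⟩ := h'.choose_spec
      rw [Option.some.inj h, he] at he'
      rwa [Option.some.inj he']
    · intro hq
      have h' : ∃ j : Fin (m + 1), ∃ e, L[(j : ℕ)]? = some e ∧ q ∈ e.1 := ⟨j, e, he, hq⟩
      simp only [φ, dif_pos h']
      obtain ⟨e', he', hq'⟩ := h'.choose_spec
      by_contra hne
      have hne : ((h'.choose : Fin (m + 1)) : ℕ) ≠ j := fun h => hne (by rw [Fin.ext h])
      have hp := hL.1
      rw [List.pairwise_iff_getElem] at hp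
      obtain ⟨a, ha⟩ := List.getElem?_eq_some_iff.1 he
      obtain ⟨a', ha'⟩ := List.getElem?_eq_some_iff.1 he'
      rcases lt_or_gt_of_ne hne with h | h
      · have := hp _ _ (by simpa using a') (by simpa using a) h
        rw [List.getElem_map, List.getElem_map, ha, ha'] at this
        exact Finset.disjoint_left.1 this hq' hq
      · have := hp _ _ (by simpa using a) (by simpa using a') h
        rw [List.getElem_map, List.getElem_map, ha, ha'] at this
        exact Finset.disjoint_left.1 this hq hq'
  have hstep : ∀ L ∈ S, ∀ L' ∈ S, φ L = φ L' → γ L = γ L' → ∀ (i : ℕ) e, L[i]? = some e →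
      L'[i]? = some e := by
    intro L hL L' hL' h1 h2 i e he
    have hi : i < m + 1 := (List.getElem?_eq_some_iff.1 he).1.trans_le (hlen L hL)
    obtain ⟨q, hq⟩ := hL.2.1 e.1 (List.mem_map_of_mem (List.mem_of_getElem? he))
    have hj := (hφ L hL ⟨i, hi⟩ e he q).2 hq
    rw [h1] at hj
    have hex : ∃ e', L'[i]? = some e' := by
      simp only [φ] at hj
      split_ifs at hj with h'
      obtain ⟨e', he', -⟩ := h'.choose_spec
      rw [Option.some.inj hj] at he'
      exact ⟨e', he'⟩
    obtain ⟨e', he'⟩ := hex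
    rw [he']
    have hset : e'.1 = e.1 := by
      ext q
      rw [← hφ L hL ⟨i, hi⟩ e he q, ← hφ L' hL' ⟨i, hi⟩ e' he' q, h1]
    have hdata : e'.2 = e.2 := by
      have := congrFun h2 ⟨i, hi⟩
      simp only [γ, he, he', Option.map_some, Option.getD_some] at this
      exact this.symm
    rw [Prod.ext hset hdata]
  have hinj : Set.InjOn (fun L => (φ L, γ L)) S := by
    intro L hL L' hL' h
    obtain ⟨h1, h2⟩ := Prod.mk.inj h
    refine List.ext_getElem? fun i => Option.ext fun e => ?_
    exact ⟨hstep L hL L' hL' h1 h2 i e, hstep L' hL' L hL h1.symm h2.symm i e⟩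
  have hmaps : (fun L => (φ L, γ L)) '' S ⊆
      (((Finset.univ : Finset (Q → Option (Fin (m + 1)))) ×ˢ Fintype.piFinset T :
        Finset ((Q → Option (Fin (m + 1))) × (Fin (m + 1) → δ))) : Set _) := by
    rintro _ ⟨L, hL, rfl⟩
    rw [Finset.mem_coe, Finset.mem_product]
    refine ⟨Finset.mem_univ _, Fintype.mem_piFinset.2 fun j => ?_⟩
    simp only [γ]
    refine Fin.cases ?_ (fun i => ?_) j
    · change _ ∈ T₀
      cases he : L[((0 : Fin (m + 1)) : ℕ)]? with
      | none => exact ht₀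
      | some e => exact hL.2.2.1 e (by rw [List.head?_eq_getElem?]; exact he)
    · change _ ∈ T₁
      cases he : L[(i.succ : ℕ)]? with
      | none => exact ht₁
      | some e =>
        refine hL.2.2.2 e (List.mem_of_getElem? (i := i) ?_)
        rw [List.getElem?_tail]
        exact he
  have hfin : S.Finite :=
    Set.Finite.of_finite_image ((Finset.finite_toSet _).subset hmaps) hinj
  refine ⟨hfin, ?_⟩
  rw [← hinj.ncard_image]
  refine (Set.ncard_le_ncard hmaps (Finset.finite_toSet _)).trans ?_
  rw [Set.ncard_coe_finset, Finset.card_product, Finset.card_univ, Fintype.card_fun,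
    Fintype.card_option, Fintype.card_fin, hQ, Fintype.card_piFinset, Fin.prod_univ_succ]
  simp [T]

variable (A : Streett Sym Q k) [Fintype Q]

/-- The codes of the states of the output automaton. -/
structure Streett.IsCode (L : List (LeafCode Q k)) : Prop where
  disjoint : (L.map Prod.fst).Pairwise Disjoint
  nonempty : ∀ S ∈ L.map Prod.fst, S.Nonempty
  bound : ∀ e ∈ L, SpineBound (Fintype.card Q) (min (Fintype.card Q) k) e.2.2 ∧ A.MaxPath [] e.2.1
  head : ∀ e ∈ L.head?, e.2.2.2 = (0, true)
  tail : ∀ e ∈ L.tail, 1 ≤ e.2.2.2.1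

theorem Streett.ncard_isCode_le {m p : ℕ} (hQ : Fintype.card Q = m + 1)
    (hp : {l | A.MaxPath [] l}.Finite ∧ {l | A.MaxPath [] l}.ncard ≤ p) (hm : 1 ≤ m) :
    {L | A.IsCode L}.Finite ∧ {L | A.IsCode L}.ncard ≤
      (m + 2) ^ (m + 1) * ((p * ((m + 1) * (2 * m + 5))) *
        (p * ((m + 1) * (2 * m + 5) * (4 * m))) ^ m) := by
  classical
  set P := hp.1.toFinset with hP
  have hPc : P.card ≤ p := by
    rw [hP, ← Set.ncard_eq_toFinset_card _ hp.1]
    exact hp.2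
  have hPn : P.Nonempty := by
    obtain ⟨l, hl⟩ := A.exists_maxPath []
    exact ⟨l, hp.1.mem_toFinset.2 hl⟩
  -- Buckets and weights; the weights are `0, …, 2(μ + 1)` with `μ ≤ m + 1`.
  set W : Finset (ℕ × ℕ) := Finset.Icc 1 (m + 1) ×ˢ Finset.range (2 * (m + 1) + 3) with hW
  have hWc : W.card = (m + 1) * (2 * m + 5) := by
    rw [hW, Finset.card_product, Nat.card_Icc, Finset.card_range, Nat.add_sub_cancel]
    ring
  have hWn : W.Nonempty := ⟨(1, 0), by simp [hW]⟩
  -- The first spine starts at the root, with depth and index `0`; other heads have depth from `1`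
  -- to `2n - 2 = 2m` and either flag.
  obtain ⟨hfin, hle⟩ := ncard_disjoint_lists_le (Q := Q) hQ
    (T₀ := P ×ˢ (W ×ˢ ({(0, true)} : Finset (ℕ × Bool))))
    (T₁ := P ×ˢ (W ×ˢ (Finset.Icc 1 (2 * m) ×ˢ (Finset.univ : Finset Bool))))
    (hPn.product (hWn.product (Finset.singleton_nonempty _)))
    (hPn.product (hWn.product ((Finset.nonempty_Icc.2 (by omega)).product Finset.univ_nonempty)))
  have hsub : {L | A.IsCode L} ⊆ _ := fun L hL => (⟨hL.disjoint, hL.nonempty, ?_, ?_⟩ : L ∈ {L |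
    (L.map Prod.fst).Pairwise Disjoint ∧ (∀ S ∈ L.map Prod.fst, S.Nonempty) ∧
      (∀ e ∈ L.head?, e.2 ∈ P ×ˢ (W ×ˢ ({(0, true)} : Finset (ℕ × Bool)))) ∧
      ∀ e ∈ L.tail, e.2 ∈ P ×ˢ (W ×ˢ (Finset.Icc 1 (2 * m) ×ˢ (Finset.univ : Finset Bool)))})
  · refine ⟨hfin.subset hsub, ((Set.ncard_le_ncard hsub hfin).trans hle).trans ?_⟩
    simp only [Finset.card_product, hWc, Finset.card_singleton, Nat.card_Icc, Finset.card_univ,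
      Fintype.card_bool, mul_one]
    have e : (m + 1) * (2 * m + 5) * ((2 * m + 1 - 1) * 2) =
        (m + 1) * (2 * m + 5) * (4 * m) := by
      rw [Nat.add_sub_cancel]
      ring
    rw [e]
    gcongr
  · intro e he
    obtain ⟨⟨hb, hw, -⟩, hpath⟩ := hL.bound e (List.mem_of_mem_head? he)
    have hz := hL.head e he
    rw [hQ] at hb hw
    simp only [Finset.mem_product, hP, Set.Finite.mem_toFinset, hW, Finset.mem_range,
      Finset.mem_singleton]
    exact ⟨hpath, ⟨hb, by omega⟩, hz⟩
  · intro e he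
    obtain ⟨⟨hb, hw, hd⟩, hpath⟩ := hL.bound e (List.mem_of_mem_tail he)
    have hz := hL.tail e he
    rw [hQ] at hb hw hd
    simp only [Finset.mem_product, hP, Set.Finite.mem_toFinset, hW, Finset.mem_range,
      Finset.mem_Icc, Finset.mem_univ, and_true] at hb ⊢
    exact ⟨hpath, ⟨hb, by omega⟩, by omega⟩

theorem keptBuckets_subset {N n μ : ℕ} (hN : N = n * (μ + 1)) : ∀ {b : Bool} {α : List (Fin k)}
    {f : Forest (Work Q k)}, f.All (A.Ripe μ N) α → keptBuckets μ b f ⊆ Finset.Icc 1 n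
  | _, _, .nil, _ => by simp [keptBuckets]
  | b, α, .cons x c r, hf => by
      unfold keptBuckets
      refine Finset.union_subset (Finset.union_subset ?_ (keptBuckets_subset hN hf.2.1))
        (keptBuckets_subset hN hf.2.2)
      split_ifs
      · intro j hj
        obtain ⟨m, hm, rfl⟩ : ∃ m, x.old = some m ∧ bucketOf μ m = j := by simpa using hj
        have := Finset.mem_Icc.1 (hf.1.range m hm)
        rw [hN] at this
        unfold bucketOf
        have h : (m - 1) / (μ + 1) < n := by
          rw [Nat.div_lt_iff_lt_mul (Nat.succ_pos μ), Nat.succ_eq_add_one]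
          omega
        exact Finset.mem_Icc.2 ⟨Nat.le_add_left _ _, h⟩
      · simp

/-- The trees that the transformation produces have codes. -/
theorem Streett.exists_isCode {N : ℕ} {pick : Finset ℕ → ℕ} (hQ : 1 ≤ Fintype.card Q)
    (hpick : ∀ U ⊂ Finset.Icc 1 (Fintype.card Q), pick U ∈ Finset.Icc 1 (Fintype.card Q))
    {f : Forest (Work Q k)} (hf : f.All (A.Ripe (min (Fintype.card Q) k) N) [])
    (hN : N = Fintype.card Q * (min (Fintype.card Q) k + 1))
    (hlen : f.roots.length ≤ 1) (hroot : ∀ x ∈ f.roots, x.idx = ⊥) :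
    ∃ L, A.IsCode L ∧ A.Coded (min (Fintype.card Q) k) 0 [] none
      (assign (min (Fintype.card Q) k) pick none
        (keptBuckets (min (Fintype.card Q) k) true f) f).1 L := by
  obtain ⟨hd, hne⟩ := A.leafSets_disjoint hf
  have hle := length_le_card_of_disjoint hd fun S hS => (hne S hS).1
  have hcard := (card_keptBuckets_add_newHeads_le (min (Fintype.card Q) k) f).1.trans hle
  have hseen : (A.seen []).card = 0 := by simp [Streett.seen]
  -- The root counts as a child of a fictitious node with `n + 1` states, so the depth budget starts
  -- with equality.
  obtain ⟨⟨L, hL, hL1, hL2⟩, -⟩ := A.exists_coded (d := 0) (s := none) (m := Fintype.card Q + 1)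
    (α := []) hpick hf ⟨List.nodup_nil, by simp⟩ (by omega) (by omega)
    (fun y _ => Nat.succ_le_succ (Finset.card_le_univ _)) (keptBuckets_subset A hN hf)
    subset_rfl hcard
  refine ⟨L, ⟨hL1 ▸ hd, fun S hS => (hne S (hL1 ▸ hS)).1, fun e he => ?_, ?_, ?_⟩, hL⟩
  · obtain ⟨h, l, hl, hp⟩ := hL2 e he
    exact ⟨h, by rwa [hl]⟩
  all_goals
    match f, hlen, hroot, hL with
    | .nil, _, _, hL =>
      obtain rfl : L = [] := hL
      simp
    | .cons x c (.cons _ _ _), hlen, _, _ => simp [Forest.roots] at hlen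
    | .cons x c .nil, _, hroot, hL =>
      have hx : x.idx = ⊥ := hroot x List.mem_cons_self
      obtain ⟨σ, i, L₁, L₂, hs, -, -, rfl, hc, hr⟩ := hL
      obtain rfl : L₂ = [] := hr
      have hσ : σ.2 = (0, true) := by
        rcases hs with ⟨h, -⟩ | ⟨-, h1, -, h2⟩
        · cases h
        · exact Prod.ext h1 (h2.2 hx)
      rw [List.append_nil]
      rcases hc with ⟨-, -, rfl⟩ | ⟨hn, -, -, hc⟩
      · simp [hσ]
      · obtain ⟨S, l, σ', T, rfl, hT, -, hσ'⟩ := hc.shape hn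
        obtain rfl := hσ' _ _ rfl
        first
          | exact hT
          | simp [hσ]

theorem Streett.keptBuckets_spine (μ : ℕ) (s : Finset Q) (α : List (Fin k)) :
    keptBuckets μ false (A.spine s α) = ∅ := by
  unfold Streett.spine
  split
  · rfl
  · next i h => simp [keptBuckets, Streett.keptBuckets_spine μ s (α ++ [i])]
termination_by (Finset.univ \ A.Cover α).card
decreasing_by exact A.card_uncovered_lt (by assumption)

theorem Streett.exists_isCode_initTree (hQ : 1 ≤ Fintype.card Q) :
    ∃ L, A.IsCode L ∧ A.Coded (min (Fintype.card Q) k) 0 [] none A.initTree L := by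
  have hpick : ∀ U ⊂ Finset.Icc 1 (Fintype.card Q),
      (fun _ => 1 : Finset ℕ → ℕ) U ∈ Finset.Icc 1 (Fintype.card Q) :=
    fun U _ => Finset.mem_Icc.2 ⟨le_rfl, hQ⟩
  have key : (A.grow [] (dropEmpty (.cons ⟨none, A.Q₀, ⊥, false⟩ .nil .nil))).All
      (A.Ripe (min (Fintype.card Q) k) (Fintype.card Q * (min (Fintype.card Q) k + 1))) [] ∧
      (A.grow [] (dropEmpty (.cons ⟨none, A.Q₀, ⊥, false⟩ .nil .nil))).roots.length ≤ 1 ∧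
      (∀ x ∈ (A.grow [] (dropEmpty (.cons ⟨none, A.Q₀, ⊥, false⟩ .nil .nil))).roots,
        x.idx = ⊥) ∧
      keptBuckets (min (Fintype.card Q) k) true
        (A.grow [] (dropEmpty (.cons ⟨none, A.Q₀, ⊥, false⟩ .nil .nil))) = ∅ := by
    by_cases h : A.Q₀ = ∅
    · simp [dropEmpty, h, Streett.grow, Forest.All, Forest.roots, keptBuckets]
    · refine ⟨A.ripe_grow ?_, ?_, ?_, ?_⟩
      · simp only [dropEmpty, h, if_false]
        exact ⟨⟨⟨Or.inl rfl, by simp [Forest.roots], by simp [Forest.roots], by simp,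
          by simp [Forest.roots]⟩, by simp [Forest.roots], Finset.nonempty_iff_ne_empty.2 h,
          by simp [Forest.roots], by simp⟩, trivial, trivial⟩
      · simp [dropEmpty, h, A.roots_grow, Forest.roots]
      · simp [dropEmpty, h, A.roots_grow, Forest.roots]
      · simp [dropEmpty, h, Streett.grow, keptBuckets, A.keptBuckets_spine]
  obtain ⟨h1, h2, h3, h4⟩ := key
  have := A.exists_isCode hQ hpick h1 rfl h2 h3
  rw [h4] at this
  exact this

theorem Streett.exists_isCode_step (hQ : 1 ≤ Fintype.card Q)
    {pick : Forest (Label Q k) → Sym → Finset ℕ → ℕ} (hpick : IsStrategy (Fintype.card Q) pick)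
    {t : Forest (Label Q k)} (ht : A.IsRSTS t) (a : Sym) :
    ∃ L, A.IsCode L ∧ A.Coded (min (Fintype.card Q) k) 0 [] none (A.step pick t a) L := by
  obtain ⟨h1, h2⟩ := A.roots_grownStep ht a
  exact A.exists_isCode hQ (fun U hU => (Finset.mem_sdiff.1 (hpick t a U hU)).1)
    (A.ripe_grownStep ht a) rfl h1 h2

theorem Streett.ncard_states_le {m p : ℕ} (hQ : Fintype.card Q = m + 1) (hm : 1 ≤ m)
    (hp : {l | A.MaxPath [] l}.Finite ∧ {l | A.MaxPath [] l}.ncard ≤ p)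
    {pick : Forest (Label Q k) → Sym → Finset ℕ → ℕ} (hpick : IsStrategy (Fintype.card Q) pick) :
    (A.determinize pick).states.Finite ∧ (A.determinize pick).states.ncard ≤
      (m + 2) ^ (m + 1) * ((p * ((m + 1) * (2 * m + 5))) *
        (p * ((m + 1) * (2 * m + 5) * (4 * m))) ^ m) := by
  have hcode : ∀ f ∈ (A.determinize pick).states, ∃ L, A.IsCode L ∧
      A.Coded (min (Fintype.card Q) k) 0 [] none f L := by
    rintro f (rfl | ⟨t, a, ht, rfl⟩)
    · exact A.exists_isCode_initTree (by omega)
    · exact A.exists_isCode_step (by omega) hpick ht a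
  choose! c hc using hcode
  have hinj : Set.InjOn c (A.determinize pick).states := fun f hf g hg h =>
    (hc f hf).2.unique (h ▸ (hc g hg).2)
  have hmaps : c '' (A.determinize pick).states ⊆ {L | A.IsCode L} := by
    rintro _ ⟨f, hf, rfl⟩
    exact (hc f hf).1
  obtain ⟨hfin, hle⟩ := A.ncard_isCode_le hQ hp hm
  refine ⟨Set.Finite.of_finite_image (hfin.subset hmaps) hinj, ?_⟩
  rw [← hinj.ncard_image]
  exact (Set.ncard_le_ncard hmaps hfin).trans hle

end Counting

end StreettDet

namespace StreettDet

/-! ### Numerical estimates -/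

section Numerics

theorem exp_one_mul_ge_one : (1 : ℝ) ≤ 0.37 * Real.exp 1 := by
  have := Real.exp_one_gt_d9
  linarith

/-- The inequality `log y ≥ 1 - 1/y` at `y = 1 + 1/x` reads `log y ≥ 1/(x + 1)`. -/
theorem exp_one_le_one_add_inv_pow {x : ℕ} (hx : 1 ≤ x) :
    Real.exp 1 ≤ (1 + 1 / (x : ℝ)) ^ (x + 1) := by
  have hx' : (0 : ℝ) < x := by exact_mod_cast hx
  have h := Real.one_sub_inv_le_log_of_pos (x := 1 + 1 / (x : ℝ)) (by positivity)
  have h2 : (1 : ℝ) - (1 + 1 / (x : ℝ))⁻¹ = 1 / (x + 1) := by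
    field_simp
    ring
  rw [h2] at h
  rw [← Real.exp_log (x := 1 + 1 / (x : ℝ)) (by positivity), ← Real.exp_nat_mul]
  apply Real.exp_le_exp.2
  push_cast
  rw [div_le_iff₀ (by positivity)] at h
  linarith

/-- Each left spine contributes at most this factor. -/
theorem spine_factor_le (m : ℕ) (hm : 2 ≤ m) :
    ((m : ℝ) + 2) * ((m + 1).factorial * ((m + 1) * (2 * m + 5)) * (4 * m)) ≤
      4096 * (0.37 * ((m : ℝ) + 1)) ^ (m + 9) := by
  induction m, hm using Nat.le_induction with
  | base => norm_num [Nat.factorial]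
  | succ m hm ih =>
    have hm' : (2 : ℝ) ≤ m := by exact_mod_cast hm
    have hpos : (0 : ℝ) < m + 1 := by positivity
    -- The growth of the left side from `m` to `m + 1` against that of the right side, with common
    -- factors cancelled.
    have hr : ((m : ℝ) + 3) * (2 * m + 7) ≤
        (0.37 * (1 + 1 / ((m : ℝ) + 1)) ^ (m + 9)) * ((2 * m + 5) * m) := by
      have h1 := exp_one_le_one_add_inv_pow (x := m + 1) (by omega)
      push_cast at h1
      have h2 : 1 + 7 * (1 / ((m : ℝ) + 1)) ≤ (1 + 1 / ((m : ℝ) + 1)) ^ 7 := by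
        have := one_add_mul_le_pow (a := 1 / ((m : ℝ) + 1))
          (le_trans (by norm_num) (by positivity : (0 : ℝ) ≤ _)) 7
        simpa using this
      -- Of the `m + 9` factors, `m + 2` produce `e`, which makes up for `0.37`; Bernoulli's
      -- inequality handles the other `7`.
      have h3 : 1 + 7 * (1 / ((m : ℝ) + 1)) ≤ 0.37 * (1 + 1 / ((m : ℝ) + 1)) ^ (m + 9) := by
        rw [show m + 9 = (m + 1 + 1) + 7 by ring, pow_add, ← mul_assoc]
        calc 1 + 7 * (1 / ((m : ℝ) + 1)) = 1 * (1 + 7 * (1 / ((m : ℝ) + 1))) := by ring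
          _ ≤ _ := mul_le_mul (exp_one_mul_ge_one.trans (by gcongr)) h2 (by positivity)
            (by positivity)
      refine le_trans ?_ (mul_le_mul_of_nonneg_right h3 (by positivity))
      have h4 : 1 + 7 * (1 / ((m : ℝ) + 1)) = (m + 8) / (m + 1) := by
        field_simp
        ring
      rw [h4, div_mul_eq_mul_div, le_div_iff₀ hpos]
      -- The difference of the two sides is `6m² + 6m - 21`.
      nlinarith [mul_nonneg (by linarith : (0 : ℝ) ≤ m - 2) (by linarith : (0 : ℝ) ≤ m)]
    have e : (0.37 * ((m : ℝ) + 1 + 1)) ^ (m + 1 + 9) = (0.37 * (m + 1)) ^ (m + 9) *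
        ((0.37 * (1 + 1 / ((m : ℝ) + 1)) ^ (m + 9)) * (m + 2)) := by
      have h1 : (m : ℝ) + 1 + 1 = (m + 1) * (1 + 1 / (m + 1)) := by field_simp
      have h2 : (m : ℝ) + 2 = (m + 1) * (1 + 1 / (m + 1)) := by rw [← h1]; ring
      rw [h1, h2, add_right_comm m 1 9, pow_succ, ← mul_assoc 0.37 ((m : ℝ) + 1) _, mul_pow]
      ring
    push_cast [Nat.factorial_succ] at ih ⊢
    rw [e]
    set X := 0.37 * (1 + 1 / ((m : ℝ) + 1)) ^ (m + 9)
    set Y := (0.37 * ((m : ℝ) + 1)) ^ (m + 9)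
    set F := (m.factorial : ℝ)
    have hF : 0 ≤ F := Nat.cast_nonneg _
    calc ((m : ℝ) + 1 + 2) * (((m : ℝ) + 1 + 1) * (((m : ℝ) + 1) * F) *
          (((m : ℝ) + 1 + 1) * (2 * (m + 1) + 5)) * (4 * (m + 1)))
        = (4 * (m + 1) ^ 2 * (m + 2) ^ 2 * F) * (((m : ℝ) + 3) * (2 * m + 7)) := by ring
      _ ≤ (4 * (m + 1) ^ 2 * (m + 2) ^ 2 * F) * (X * ((2 * m + 5) * m)) := by gcongr
      _ = (((m : ℝ) + 2) * ((((m : ℝ) + 1) * F) * ((m + 1) * (2 * m + 5)) * (4 * m))) *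
          (X * (m + 2)) := by ring
      _ ≤ (4096 * Y) * (X * (m + 2)) := by gcongr
      _ = _ := by ring

theorem explicit_bound (m : ℕ) (hm : 1 ≤ m) :
    (((m + 2) ^ (m + 1) * (((m + 1).factorial * ((m + 1) * (2 * m + 5))) *
        ((m + 1).factorial * ((m + 1) * (2 * m + 5) * (4 * m))) ^ m) : ℕ) : ℝ) ≤
      2 ^ (12 * (m + 1)) * (0.37 * ((m + 1 : ℕ) : ℝ)) ^ ((m + 1) ^ 2 + 8 * (m + 1)) := by
  rcases Nat.lt_or_ge m 2 with h | h
  -- The bound per spine fails for `m = 1`, but the product still satisfies the claim.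
  · obtain rfl : m = 1 := by omega
    norm_num [Nat.factorial]
  · have hb := spine_factor_le m h
    have hm' : (1 : ℝ) ≤ m := by exact_mod_cast hm
    have e : (m + 1) ^ 2 + 8 * (m + 1) = (m + 9) * (m + 1) := by ring
    rw [e, pow_mul, pow_mul, ← mul_pow]
    push_cast
    have h4096 : (2 : ℝ) ^ 12 = 4096 := by norm_num
    rw [h4096]
    have hb' := pow_le_pow_left₀ (by positivity) hb (m + 1)
    rw [mul_pow ((m : ℝ) + 2)] at hb'
    refine le_trans (mul_le_mul_of_nonneg_left ?_ (by positivity)) hb'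
    rw [pow_succ', ← mul_assoc ((m + 1).factorial : ℝ) (((m : ℝ) + 1) * (2 * m + 5)) (4 * m)]
    refine mul_le_mul_of_nonneg_right ?_ (by positivity)
    -- The root's factor lacks `4 * m` and is padded, so that all `m + 1` factors agree.
    exact le_mul_of_one_le_right (by positivity) (by linarith)

theorem explicit_bound_isBigO (n : ℕ) (hn : 2 ≤ n) :
    (2 : ℝ) ^ (12 * n) * (0.37 * (n : ℝ)) ^ (n ^ 2 + 8 * n) ≤
      (2 : ℝ) ^ ((11 : ℝ) * ((n : ℝ) ^ 2 * Real.logb 2 n)) := by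
  have hn' : (2 : ℝ) ≤ n := by exact_mod_cast hn
  have hn0 : (0 : ℝ) < n := by linarith
  have hlog : 1 ≤ Real.logb 2 n := by
    rw [Real.le_logb_iff_rpow_le (by norm_num) hn0]
    simpa using hn'
  have h1 : (0.37 * (n : ℝ)) ^ (n ^ 2 + 8 * n) ≤
      (2 : ℝ) ^ (Real.logb 2 n * ((n ^ 2 + 8 * n : ℕ) : ℝ)) := by
    rw [Real.rpow_mul (by norm_num), Real.rpow_logb (by norm_num) (by norm_num) hn0,
      Real.rpow_natCast]
    exact pow_le_pow_left₀ (by positivity) (by linarith) _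
  calc (2 : ℝ) ^ (12 * n) * (0.37 * (n : ℝ)) ^ (n ^ 2 + 8 * n)
      ≤ (2 : ℝ) ^ ((12 * n : ℕ) : ℝ) * (2 : ℝ) ^ (Real.logb 2 n * ((n ^ 2 + 8 * n : ℕ) : ℝ)) := by
        rw [Real.rpow_natCast]
        gcongr
    _ = (2 : ℝ) ^ (((12 * n : ℕ) : ℝ) + Real.logb 2 n * ((n ^ 2 + 8 * n : ℕ) : ℝ)) := by
        rw [Real.rpow_add (by norm_num)]
    _ ≤ _ := by
        refine Real.rpow_le_rpow_of_exponent_le (by norm_num) ?_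
        push_cast
        -- With `L = lg n ≥ 1` and `n ≥ 2`: `12n ≤ 6n²L` and `8nL ≤ 4n²L`, so the constant is `6 + 1
        -- + 4 = 11`.
        nlinarith [mul_nonneg (mul_nonneg hn0.le (by linarith : (0 : ℝ) ≤ n - 2))
          (by linarith : 0 ≤ Real.logb 2 n), mul_nonneg hn0.le (by linarith : 0 ≤ Real.logb 2 n - 1)]

/-- The number of codes in terms of `n = m + 1` and `k`. -/
theorem small_index_bound (m k : ℕ) (hm : 1 ≤ m) (hk : 1 ≤ k) :
    (((m + 2) ^ (m + 1) * (((k + 1) ^ k * ((m + 1) * (2 * m + 5))) *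
        ((k + 1) ^ k * ((m + 1) * (2 * m + 5) * (4 * m))) ^ m) : ℕ) : ℝ) ≤
      (2 : ℝ) ^ ((15 : ℝ) * (((m + 1 : ℕ) : ℝ) * Real.logb 2 (m + 1 : ℕ) +
        ((m + 1 : ℕ) : ℝ) * k * Real.logb 2 k)) := by
  set n := m + 1 with hn
  have hn2 : 2 ≤ n := by omega
  have hn' : (2 : ℝ) ≤ n := by exact_mod_cast hn2
  have hn0 : (0 : ℝ) < n := by linarith
  have hk' : (1 : ℝ) ≤ k := by exact_mod_cast hk
  have hlog : 1 ≤ Real.logb 2 n := by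
    rw [Real.le_logb_iff_rpow_le (by norm_num) hn0]
    simpa using hn'
  have hlogk : 0 ≤ Real.logb 2 k := Real.logb_nonneg (by norm_num) hk'
  have hnat : (m + 2) ^ n * (((k + 1) ^ k * (n * (2 * m + 5))) *
      ((k + 1) ^ k * (n * (2 * m + 5) * (4 * m))) ^ m) ≤
      (n ^ 2) ^ n * ((2 * k) ^ k * (n * n ^ 4 * n ^ 3)) ^ n := by
    have h1 : m + 2 ≤ n ^ 2 := by nlinarith
    have h2 : k + 1 ≤ 2 * k := by omega
    have h3 : 2 * m + 5 ≤ n ^ 4 := by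
      have : 4 * 4 ≤ n ^ 2 * n ^ 2 := Nat.mul_le_mul (by nlinarith) (by nlinarith)
      have h4 : n ^ 4 = n ^ 2 * n ^ 2 := by ring
      nlinarith
    have h4 : 4 * m ≤ n ^ 3 := by
      have : 4 * n ≤ n ^ 2 * n := Nat.mul_le_mul (by nlinarith) le_rfl
      have h4 : n ^ 3 = n ^ 2 * n := by ring
      omega
    have h5 : n * (2 * m + 5) ≤ n * n ^ 4 * n ^ 3 := by
      calc n * (2 * m + 5) ≤ n * n ^ 4 := by gcongr
        _ ≤ _ := Nat.le_mul_of_pos_right _ (by positivity)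
    have e : ((2 * k) ^ k * (n * n ^ 4 * n ^ 3)) ^ n = ((2 * k) ^ k * (n * n ^ 4 * n ^ 3)) *
        ((2 * k) ^ k * (n * n ^ 4 * n ^ 3)) ^ m := by
      rw [hn, pow_succ, mul_comm]
    rw [e]
    gcongr
  have hexp : (((n ^ 2) ^ n * ((2 * k) ^ k * (n * n ^ 4 * n ^ 3)) ^ n : ℕ) : ℝ) =
      (2 : ℝ) ^ (10 * (n * Real.logb 2 n) + (n * k + n * k * Real.logb 2 k)) := by
    have e : (((n ^ 2) ^ n * ((2 * k) ^ k * (n * n ^ 4 * n ^ 3)) ^ n : ℕ) : ℝ) =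
        (n : ℝ) ^ (10 * n) * (2 ^ (n * k) * (k : ℝ) ^ (n * k)) := by
      push_cast
      have : (n : ℝ) * n ^ 4 * n ^ 3 = n ^ 8 := by ring
      rw [this, mul_pow, ← pow_mul, ← pow_mul, ← pow_mul, mul_pow, mul_comm k n]
      have : 10 * n = 2 * n + 8 * n := by ring
      rw [this, pow_add]
      ring
    have h2 : ∀ (x : ℝ) (a : ℕ), 0 < x → x ^ a = (2 : ℝ) ^ ((a : ℝ) * Real.logb 2 x) := by
      intro x a hx
      rw [mul_comm, Real.rpow_mul (by norm_num), Real.rpow_logb (by norm_num) (by norm_num) hx,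
        Real.rpow_natCast]
    rw [e, h2 n _ hn0, h2 k _ (by linarith), ← Real.rpow_natCast 2 (n * k),
      ← Real.rpow_add (by norm_num), ← Real.rpow_add (by norm_num)]
    congr 1
    push_cast
    ring
  refine (Nat.cast_le.2 hnat).trans (hexp.trans_le ?_)
  refine Real.rpow_le_rpow_of_exponent_le (by norm_num) ?_
  -- The term `nk` stems from `k + 1 ≤ 2k`. It is absorbed by `lg k ≥ 1` if `k ≥ 2`, and by `lg n ≥
  -- 1` if `k = 1`.
  have hnk : (n : ℝ) * k ≤ n * Real.logb 2 n + n * k * Real.logb 2 k := by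
    rcases hk.eq_or_lt with rfl | hk2
    · simp
      nlinarith
    · have hk2' : (2 : ℝ) ≤ k := by exact_mod_cast hk2
      have : 1 ≤ Real.logb 2 k := by
        rw [Real.le_logb_iff_rpow_le (by norm_num) (by linarith)]
        simpa using hk2'
      have h1 : 0 ≤ (n : ℝ) * Real.logb 2 n := by positivity
      have h2 : (n : ℝ) * k * 1 ≤ n * k * Real.logb 2 k := by gcongr
      linarith
  have h1 : 0 ≤ (n : ℝ) * Real.logb 2 n := by positivity
  have h2 : 0 ≤ (n : ℝ) * k * Real.logb 2 k := by positivity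
  linarith

end Numerics

end StreettDet

/-! ### The complexity bounds -/

theorem mainTheorem2 :
    -- the explicit bound on the number of states, for any number `k` of pairs
    (∀ (Sym : Type*) (Q : Type*) [Fintype Q] [DecidableEq Q] (n k : ℕ)
        (A : StreettDet.Streett Sym Q k)
        (pick : StreettDet.Forest (StreettDet.Label Q k) → Sym → Finset ℕ → ℕ),
        Fintype.card Q = n → 2 ≤ n → StreettDet.IsStrategy n pick →
        (A.determinize pick).states.Finite ∧
        ((A.determinize pick).states.ncard : ℝ) ≤
          2 ^ (12 * n) * (0.37 * (n : ℝ)) ^ (n ^ 2 + 8 * n)) ∧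
    -- the explicit bound is `2 ^ O(n² lg n)`
    (∃ C : ℝ, ∀ n : ℕ, 2 ≤ n →
        (2 : ℝ) ^ (12 * n) * (0.37 * (n : ℝ)) ^ (n ^ 2 + 8 * n) ≤
          (2 : ℝ) ^ (C * ((n : ℝ) ^ 2 * Real.logb 2 n))) ∧
    -- the index size is `O(n²)`, for any `k`
    (∃ C : ℝ, ∀ (Sym : Type*) (Q : Type*) [Fintype Q] [DecidableEq Q] (n k : ℕ)
        (A : StreettDet.Streett Sym Q k)
        (pick : StreettDet.Forest (StreettDet.Label Q k) → Sym → Finset ℕ → ℕ),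
        Fintype.card Q = n → StreettDet.IsStrategy n pick →
        ((A.determinize pick).Idx.card : ℝ) ≤ C * (n : ℝ) ^ 2) ∧
    -- the bounds for `k = O(n)`
    (∀ c : ℝ, ∃ C : ℝ, ∀ (Sym : Type*) (Q : Type*) [Fintype Q] [DecidableEq Q] (n k : ℕ)
        (A : StreettDet.Streett Sym Q k)
        (pick : StreettDet.Forest (StreettDet.Label Q k) → Sym → Finset ℕ → ℕ),
        Fintype.card Q = n → 1 ≤ k → (k : ℝ) ≤ c * n → StreettDet.IsStrategy n pick →
        (2 ≤ n → ((A.determinize pick).states.ncard : ℝ) ≤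
          (2 : ℝ) ^ (C * ((n : ℝ) * Real.logb 2 n + (n : ℝ) * k * Real.logb 2 k))) ∧
        ((A.determinize pick).Idx.card : ℝ) ≤ C * ((n : ℝ) * k)) := by
  refine ⟨?_, ⟨11, StreettDet.explicit_bound_isBigO⟩, ⟨2, ?_⟩, fun c => ⟨15, ?_⟩⟩
  · intro Sym Q _ _ n k A pick hQ hn hpick
    obtain ⟨m, rfl⟩ : ∃ m, n = m + 1 := ⟨n - 1, by omega⟩
    have hp := A.ncard_maxPath_le []
    rw [hQ] at hp
    have hs : Nat.factorial (m + 1 - (A.seen []).card) ≤ (m + 1).factorial :=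
      Nat.factorial_le (Nat.sub_le _ _)
    obtain ⟨h1, h2⟩ := A.ncard_states_le hQ (by omega) ⟨hp.1, hp.2.trans hs⟩ (hQ ▸ hpick)
    exact ⟨h1, (Nat.cast_le.2 h2).trans (StreettDet.explicit_bound m (by omega))⟩
  · intro Sym Q _ _ n k A pick hQ _
    change ((Finset.Icc 1 (Fintype.card Q * (min (Fintype.card Q) k + 1))).card : ℝ) ≤ _
    rw [Nat.card_Icc, Nat.add_sub_cancel, hQ]
    have h : n * (min n k + 1) ≤ 2 * n ^ 2 := by
      have := Nat.mul_le_mul_left n (Nat.min_le_left n k)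
      nlinarith [Nat.le_self_pow two_ne_zero n]
    exact_mod_cast h
  · intro Sym Q _ _ n k A pick hQ hk _ hpick
    constructor
    · intro hn
      obtain ⟨m, rfl⟩ : ∃ m, n = m + 1 := ⟨n - 1, by omega⟩
      have h := (A.ncard_states_le hQ (by omega) A.ncard_maxPath_le_pow (hQ ▸ hpick)).2
      exact (Nat.cast_le.2 h).trans (StreettDet.small_index_bound m k (by omega) hk)
    · change ((Finset.Icc 1 (Fintype.card Q * (min (Fintype.card Q) k + 1))).card : ℝ) ≤ _
      rw [Nat.card_Icc, Nat.add_sub_cancel, hQ]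
      have h : n * (min n k + 1) ≤ 15 * (n * k) := by
        have := Nat.mul_le_mul_left n (Nat.min_le_right n k)
        have := Nat.mul_le_mul_left n hk
        nlinarith
      exact_mod_cast h
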